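/- Let $\theta\in\mathbb{R}^n$ be unknown, let $C\in\mathbb{R}$, and consider the system $y_k=\phi_k^\top\theta+d_k$, $k\ge 1$, observed only through the binary measurements $s_k=I_{\{y_k\le C\}}$. Assume: 1. The (deterministic) regressors $\phi_k\in\mathbb{R}^n$ satisfy $\sup_{k\ge1}\|\phi_k\|\le M<\infty$, and there are a positive integer $N\ge n$ and a $\delta>0$ such that $\frac1N\sum_{i=k}^{k+N-1}\phi_i\phi_i^\top\ge\delta I_n$ (in the positive semidefinite order) for all $k\ge1$. 2. The noise $\{d_k\}_{k\ge1}$ is a sequence of i.i.d. random variables with zero mean and finite variance $\sigma^2$, with distribution function $F$ and density $f$; $F$ is Lipschitz continuous, and $\inf_{x\in X}f(x)>0$ for every nonempty bounded open set $X\subset\mathbb{R}$. For a constant $\beta>0$ and a deterministic initial value $\hat\theta_0\in\mathbb{R}^n$, let $$\hat\theta_k=\hat\theta_{k-1}+\frac{\beta\phi_k}{k}\left(F\left(C-\phi_k^\top\hat\theta_{k-1}\right)-s_k\right),\quad k\ge1,\qquad \tilde\theta_k=\hat\theta_k-\theta,$$ and put $$\eta=\beta\delta\underline f,\qquad \underline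 f=\lim_{z\to(M\|\theta\|)^+}\ \inf_{t\in[C-z,C+z]}f(t).$$ Then $\mathbb{E}\|\tilde\theta_k\|^2<\infty$ for every $k$ and, for any $\varepsilon>0$, as $k\to\infty$, $$\mathbb{E}\|\tilde\theta_k\|^2=\begin{cases}O\left(\frac1k\right),&\eta>\frac12;\\ O\left(\frac1{k^{2\eta-\varepsilon}}\right),&\eta\le\frac12.\end{cases}$$ If, moreover, $f$ is locally Lipschitz continuous, then $$\mathbb{E}\|\tilde\theta_k\|^2=\begin{cases}O\left(\frac1k\right),&\eta>\frac12;\\ O\left(\frac{\ln k}k\right),&\eta=\frac12;\\ O\left(\frac1{k^{2\eta}}\right),&\eta<\frac12.\end{cases}$$ -/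

import Mathlib

open MeasureTheory ProbabilityTheory Filter Topology Set
open scoped NNReal ENNReal

/-- The condition on the (deterministic) regressors `φ 1, φ 2, …`: they are bounded in norm by `M`,
and they are uniformly persistently exciting with window length `N ≥ n` and level `δ > 0`, i.e.
`(1/N) ∑_{i=k}^{k+N-1} φ i (φ i)ᵀ ≥ δ Iₙ` in the Loewner order for every `k ≥ 1`.
The value `φ 0` is irrelevant. -/
structure PersistentlyExciting {n : ℕ} (φ : ℕ → EuclideanSpace ℝ (Fin n))
    (M : ℝ) (N : ℕ) (δ : ℝ) : Prop where
  norm_le : ∀ k : ℕ, 1 ≤ k → ‖φ k‖ ≤ M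
  pos_window : 0 < N
  le_window : n ≤ N
  pos_level : 0 < δ
  excitation : ∀ k : ℕ, 1 ≤ k →
    (((1 / (N : ℝ)) • ∑ i ∈ Finset.Ico k (k + N), Matrix.vecMulVec (φ i).ofLp (φ i).ofLp)
      - δ • (1 : Matrix (Fin n) (Fin n) ℝ)).PosSemidef

/-- The condition on the noise `d 1, d 2, …`: i.i.d. real random variables with zero mean and finite
variance `σ ^ 2`, with distribution function `F` and density `f`; `F` is Lipschitz, and the infimum
of `f` over any (nonempty) bounded open set is positive (in particular `f > 0` everywhere).
The value `d 0` is irrelevant. -/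
structure AdmissibleNoise {Ω : Type*} [MeasurableSpace Ω] (P : Measure Ω)
    (d : ℕ → Ω → ℝ) (σ : ℝ) (F f : ℝ → ℝ) : Prop where
  measurable : ∀ k : ℕ, 1 ≤ k → Measurable (d k)
  indep : iIndepFun (fun k : ℕ => d (k + 1)) P
  distribution : ∀ k : ℕ, 1 ≤ k → ∀ x : ℝ, F x = P.real {ω | d k ω ≤ x}
  measurable_density : Measurable f
  density : ∀ k : ℕ, 1 ≤ k →
    P.map (d k) = (volume : Measure ℝ).withDensity (fun x => ENNReal.ofReal (f x))
  memLp_two : ∀ k : ℕ, 1 ≤ k → MemLp (d k) 2 P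
  mean_zero : ∀ k : ℕ, 1 ≤ k → ∫ ω, d k ω ∂P = 0
  variance_eq : ∀ k : ℕ, 1 ≤ k → variance (d k) P = σ ^ 2
  lipschitz : ∃ K : ℝ≥0, LipschitzWith K F
  density_inf_pos : ∀ X : Set ℝ, IsOpen X → Bornology.IsBounded X → X.Nonempty →
    0 < sInf (f '' X)

/-- The unobserved output `y_k = φ_kᵀ θ + d_k`. -/
noncomputable def output {n : ℕ} {Ω : Type*} (φ : ℕ → EuclideanSpace ℝ (Fin n))
    (θ : EuclideanSpace ℝ (Fin n)) (d : ℕ → Ω → ℝ) (k : ℕ) (ω : Ω) : ℝ :=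
  inner ℝ (φ k) θ + d k ω

open Classical in
/-- The binary observation `s_k = I_{y_k ≤ C}`. -/
noncomputable def binaryObs {n : ℕ} {Ω : Type*} (φ : ℕ → EuclideanSpace ℝ (Fin n))
    (θ : EuclideanSpace ℝ (Fin n)) (d : ℕ → Ω → ℝ) (C : ℝ) (k : ℕ) (ω : Ω) : ℝ :=
  if output φ θ d k ω ≤ C then 1 else 0

/-- The stochastic approximation algorithm with initial value `θ₀`:
`θ̂_k = θ̂_{k-1} + (β φ_k / k) (F (C - φ_kᵀ θ̂_{k-1}) - s_k)` for `k ≥ 1`,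
driven by a sequence of observations `s`. -/
noncomputable def saEstimate {n : ℕ} {Ω : Type*} (φ : ℕ → EuclideanSpace ℝ (Fin n))
    (F : ℝ → ℝ) (C β : ℝ) (s : ℕ → Ω → ℝ) (θ₀ : EuclideanSpace ℝ (Fin n)) :
    ℕ → Ω → EuclideanSpace ℝ (Fin n)
  | 0, _ => θ₀
  | k + 1, ω =>
      saEstimate φ F C β s θ₀ k ω +
        (β / ((k + 1 : ℕ) : ℝ) *
          (F (C - inner ℝ (φ (k + 1)) (saEstimate φ F C β s θ₀ k ω)) - s (k + 1) ω)) • φ (k + 1)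

/-- The estimation error `θ̃_k = θ̂_k - θ` of the algorithm run on the binary observations. -/
noncomputable def estError {n : ℕ} {Ω : Type*} (φ : ℕ → EuclideanSpace ℝ (Fin n))
    (θ : EuclideanSpace ℝ (Fin n)) (d : ℕ → Ω → ℝ) (F : ℝ → ℝ) (C β : ℝ)
    (θ₀ : EuclideanSpace ℝ (Fin n)) (k : ℕ) (ω : Ω) : EuclideanSpace ℝ (Fin n) :=
  saEstimate φ F C β (binaryObs φ θ d C) θ₀ k ω - θ

/-- The right limit, as `z ↓ r`, of the infimum of `f` over `[C - z, C + z]`. -/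
noncomputable def lowerDensity (f : ℝ → ℝ) (C r : ℝ) : ℝ :=
  limUnder (𝓝[>] r) (fun z : ℝ => sInf (f '' Icc (C - z) (C + z)))

/-- For a nonnegative function and `r ≥ 0` the right limit in `lowerDensity` exists. -/
theorem tendsto_lowerDensity (f : ℝ → ℝ) (hf : ∀ x, 0 ≤ f x) (C r : ℝ) (hr : 0 ≤ r) :
    Tendsto (fun z : ℝ => sInf (f '' Icc (C - z) (C + z))) (𝓝[>] r)
      (𝓝 (lowerDensity f C r)) := by
  refine tendsto_nhds_limUnder ?_
  have hanti : AntitoneOn (fun z : ℝ => sInf (f '' Icc (C - z) (C + z))) (Ioi r) := by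
    intro a ha b _ hab
    have ha' : r < a := ha
    refine csInf_le_csInf ⟨0, ?_⟩ ?_ ?_
    · rintro _ ⟨x, _, rfl⟩
      exact hf x
    · exact ⟨f C, C, ⟨by linarith, by linarith⟩, rfl⟩
    · exact image_mono (Icc_subset_Icc (by linarith) (by linarith))
  have hbdd : BddAbove ((fun z : ℝ => sInf (f '' Icc (C - z) (C + z))) '' Ioi r) := by
    refine ⟨f C, ?_⟩
    rintro _ ⟨z, hz, rfl⟩
    have hz' : r < z := hz
    refine csInf_le ⟨0, ?_⟩ ⟨C, ⟨by linarith, by linarith⟩, rfl⟩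
    rintro _ ⟨x, _, rfl⟩
    exact hf x
  exact ⟨_, hanti.tendsto_nhdsGT hbdd⟩

/-!
The error `x k = θ̂_k - θ` follows a stochastic approximation recursion with gains `β / k`: its
noise is a bounded martingale difference, and the distribution function, being strictly increasing
with a positive density, supplies a restoring force in the direction of the regressor. Persistent
excitation makes the accumulated force nondegenerate over every window of length `N`.

Far from the origin the force is only known to be bounded below, so that the norm drifts inwards at
rate at least `const / k`. Since the increments are `O(1 / k)`, the exponential moments
`E exp (l √(1 + ‖x j‖²))` with `l` proportional to `m` contract from window to window for `j ≥ m`;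
for `m` about `k ^ α` with a small `α` this makes `P (‖x k‖ ≥ ρ)` decay faster than any power of
`k`. Near the origin the force is at least `(f' - L |u|) u`, and the Lyapunov function
`‖v‖² + B ‖v‖³` with `B` large contracts by a factor `1 - 2 β δ f' N / k` over a window, up to
`O(1 / k²)`: the cubic term pays for the loss `L |u|`. The rates are those of the resulting scalar
recursion. For `L = 0` any `f'` below `lowerDensity f C (M * ‖θ‖)` is admissible; if `f` is locally
Lipschitz, `f'` may be taken equal to it.
-/

section WindowContraction

theorem log_add_sub_log_le {a b : ℝ} (ha : 0 < a) (hb : 0 ≤ b) :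
    Real.log (a + b) - Real.log a ≤ b / a := by
  rw [← Real.log_div (by positivity) ha.ne']
  refine (Real.log_le_sub_one_of_pos (by positivity)).trans_eq ?_
  field_simp
  ring

theorem one_sub_mul_rpow_neg_le {p k h : ℝ} (hp : 0 ≤ p) (hk : 0 < k) (hh : 0 ≤ h) :
    (1 - p * h / k) * k ^ (-p) ≤ (k + h) ^ (-p) := by
  rw [Real.rpow_def_of_pos hk, Real.rpow_def_of_pos (by positivity)]
  calc (1 - p * h / k) * Real.exp (Real.log k * -p)
      ≤ Real.exp (-(p * h / k)) * Real.exp (Real.log k * -p) := by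
        gcongr
        exact Real.one_sub_le_exp_neg _
    _ = Real.exp (-(p * (h / k)) + Real.log k * -p) := by rw [← Real.exp_add, mul_div_assoc]
    _ ≤ Real.exp (Real.log (k + h) * -p) := by
        gcongr
        linarith [mul_le_mul_of_nonneg_left (log_add_sub_log_le hk hh) hp]

theorem exists_le_mul_add_of_supersolution {e a r G D : ℕ → ℝ} {N : ℕ} (hN : 0 < N)
    (ha : ∀ᶠ k in atTop, 0 ≤ a k) (he : ∀ᶠ k in atTop, e (k + N) ≤ a k * e k + r k)
    (hGpos : ∀ᶠ k in atTop, 0 < G k) (hG : ∀ᶠ k in atTop, a k * G k ≤ G (k + N))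
    (hD : ∀ᶠ k in atTop, a k * D k + r k ≤ D (k + N)) :
    ∃ b, 0 ≤ b ∧ ∀ᶠ k in atTop, e k ≤ b * G k + D k := by
  obtain ⟨m, hm⟩ := eventually_atTop.1 (ha.and (he.and (hGpos.and (hG.and hD))))
  obtain ⟨b, hb⟩ := ((Finset.Ico m (m + N)).image fun k => (e k - D k) / G k).bddAbove
  refine ⟨max b 0, le_max_right _ _, eventually_atTop.2 ⟨m, fun k => ?_⟩⟩
  induction k using Nat.strong_induction_on with
  | _ k ih =>
    intro hk
    rcases lt_or_ge k (m + N) with hkN | hkN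
    · have hratio : (e k - D k) / G k ≤ b :=
        hb (Finset.mem_coe.2 (Finset.mem_image_of_mem _ (Finset.mem_Ico.2 ⟨hk, hkN⟩)))
      have hGk := (hm k hk).2.2.1
      rw [div_le_iff₀ hGk] at hratio
      linarith [mul_le_mul_of_nonneg_right (le_max_left b 0) hGk.le]
    · obtain ⟨j, rfl⟩ : ∃ j, k = j + N := ⟨k - N, by omega⟩
      obtain ⟨ha, he, -, hG, hD⟩ := hm j (by omega)
      calc e (j + N) ≤ a j * e j + r j := he
        _ ≤ a j * (max b 0 * G j + D j) + r j := by
            gcongr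
            exact ih j (by omega) (by omega)
        _ = max b 0 * (a j * G j) + (a j * D j + r j) := by ring
        _ ≤ max b 0 * G (j + N) + D (j + N) := by gcongr

/-- The asymptotic recursion `e (k + N) ≤ (1 - p N / k) e k + c / k²` over windows of length `N`,
which makes `e` decay like `k ^ (-p)`, but not faster than `1 / k`. -/
def IsWindowContraction (e : ℕ → ℝ) (N : ℕ) (p c : ℝ) : Prop :=
  ∀ᶠ k : ℕ in atTop, e (k + N) ≤ (1 - p * N / k) * e k + c / (k : ℝ) ^ 2

theorem eventually_natCast_pos : ∀ᶠ k : ℕ in atTop, (0 : ℝ) < k :=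
  tendsto_natCast_atTop_atTop.eventually_gt_atTop 0

theorem eventually_one_sub_div_nonneg (q : ℝ) : ∀ᶠ k : ℕ in atTop, 0 ≤ 1 - q / (k : ℝ) := by
  filter_upwards [eventually_natCast_pos, tendsto_natCast_atTop_atTop.eventually_ge_atTop q]
    with k hk hqk
  rwa [sub_nonneg, div_le_one hk]

theorem eventually_one_sub_mul_rpow_neg_le {p : ℝ} (hp : 0 ≤ p) (N : ℕ) :
    ∀ᶠ k : ℕ in atTop, (1 - p * N / k) * (k : ℝ) ^ (-p) ≤ ((k + N : ℕ) : ℝ) ^ (-p) := by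
  filter_upwards [eventually_natCast_pos] with k hk
  exact_mod_cast one_sub_mul_rpow_neg_le hp hk N.cast_nonneg

theorem eventually_one_sub_mul_div_add_le {p c D : ℝ} {N : ℕ} (hD : c < D * (p - 1) * N) :
    ∀ᶠ k : ℕ in atTop,
      (1 - p * N / k) * (D / k) + c / (k : ℝ) ^ 2 ≤ D / ((k + N : ℕ) : ℝ) := by
  have hlim : Tendsto (fun k : ℕ => D * N ^ 2 / ((k : ℝ) + N)) atTop (𝓝 0) :=
    (tendsto_atTop_add_const_right _ _ tendsto_natCast_atTop_atTop).const_div_atTop _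
  filter_upwards [eventually_natCast_pos, hlim.eventually_const_le (sub_neg.2 hD)] with k hk hlow
  have hdiff : D / ((k + N : ℕ) : ℝ) - (1 - p * N / k) * (D / k)
      = (D * (p - 1) * N + D * N ^ 2 / (k + N)) / (k : ℝ) ^ 2 := by
    push_cast
    field_simp
    ring
  have hc : c / (k : ℝ) ^ 2 ≤ (D * (p - 1) * N + D * N ^ 2 / (k + N)) / (k : ℝ) ^ 2 := by
    gcongr
    linarith
  linarith

theorem one_sub_mul_log_div_add_le {k N : ℝ} (hN : 0 < N) (hNk : N ≤ k) (hk : 1 ≤ k) :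
    (1 - N / k) * (Real.log k / k) + N / (4 * k ^ 2) ≤ Real.log (k + N) / (k + N) := by
  have hk₀ : 0 < k := by linarith
  have hlog : Real.log k + N / (k + N) ≤ Real.log (k + N) := by
    have := Real.one_sub_inv_le_log_of_pos (show 0 < (k + N) / k by positivity)
    rw [Real.log_div (by positivity) hk₀.ne', inv_div] at this
    have : 1 - k / (k + N) = N / (k + N) := by
      field_simp
      ring
    linarith
  have hinv : (1 - N / k) * (1 / k) ≤ 1 / (k + N) := by
    simpa [Real.rpow_neg_one] using one_sub_mul_rpow_neg_le zero_le_one hk₀ hN.le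
  have hsq : N / (4 * k ^ 2) ≤ N / (k + N) ^ 2 := by
    gcongr
    nlinarith
  calc (1 - N / k) * (Real.log k / k) + N / (4 * k ^ 2)
      = Real.log k * ((1 - N / k) * (1 / k)) + N / (4 * k ^ 2) := by ring
    _ ≤ Real.log k * (1 / (k + N)) + N / (k + N) ^ 2 := by
        have := Real.log_nonneg hk
        gcongr
    _ = (Real.log k + N / (k + N)) / (k + N) := by
        field_simp
    _ ≤ Real.log (k + N) / (k + N) := by gcongr

namespace IsWindowContraction

variable {e : ℕ → ℝ} {N : ℕ} {p c : ℝ}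

theorem exists_le_rpow_add_inv (h : IsWindowContraction e N p c) (hN : 0 < N) (hp : 0 ≤ p)
    (hp₁ : p ≠ 1) (hc : 0 ≤ c) :
    ∃ b D : ℝ, 0 ≤ b ∧ 0 < D * (p - 1) ∧
      ∀ᶠ k : ℕ in atTop, e k ≤ b * (k : ℝ) ^ (-p) + D / k := by
  have hp₁' : p - 1 ≠ 0 := sub_ne_zero.2 hp₁
  have hN' : (0 : ℝ) < N := by exact_mod_cast hN
  have hD : (c + 1) / (N * (p - 1)) * (p - 1) = (c + 1) / N := by field_simp
  obtain ⟨b, hb, hle⟩ := exists_le_mul_add_of_supersolution (G := fun k => (k : ℝ) ^ (-p))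
    (D := fun k => (c + 1) / (N * (p - 1)) / k) hN (eventually_one_sub_div_nonneg (p * N)) h
    (eventually_natCast_pos.mono fun k hk => Real.rpow_pos_of_pos hk _)
    (eventually_one_sub_mul_rpow_neg_le hp N)
    (eventually_one_sub_mul_div_add_le (by rw [hD, div_mul_cancel₀ _ hN'.ne']; linarith))
  exact ⟨b, _, hb, by rw [hD]; positivity, hle⟩

theorem isBigO_inv (h : IsWindowContraction e N p c) (hN : 0 < N) (hp : 1 < p) (hc : 0 ≤ c)
    (he : ∀ k, 0 ≤ e k) : e =O[atTop] fun k : ℕ => 1 / (k : ℝ) := by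
  obtain ⟨b, D, hb, -, hle⟩ := h.exists_le_rpow_add_inv hN (by linarith) hp.ne' hc
  refine Asymptotics.IsBigO.of_bound (b + D) ?_
  filter_upwards [hle, eventually_ge_atTop 1] with k hk hk₁
  rw [Real.norm_of_nonneg (he k), Real.norm_of_nonneg (by positivity)]
  calc e k ≤ b * (k : ℝ) ^ (-p) + D / k := hk
    _ ≤ b * (k : ℝ) ^ (-1 : ℝ) + D / k := by
        gcongr
        exact_mod_cast hk₁
    _ = (b + D) * (1 / k) := by
        rw [Real.rpow_neg_one]
        ring

theorem isBigO_rpow (h : IsWindowContraction e N p c) (hN : 0 < N) (hp : 0 ≤ p) (hp₁ : p < 1)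
    (hc : 0 ≤ c) (he : ∀ k, 0 ≤ e k) : e =O[atTop] fun k : ℕ => 1 / (k : ℝ) ^ p := by
  obtain ⟨b, D, -, hD, hle⟩ := h.exists_le_rpow_add_inv hN hp hp₁.ne hc
  have hD₀ : D < 0 := neg_of_mul_pos_left hD (sub_neg.2 hp₁).le
  refine Asymptotics.IsBigO.of_bound b ?_
  filter_upwards [hle, eventually_natCast_pos] with k hk hk₀
  rw [Real.norm_of_nonneg (he k), Real.norm_of_nonneg (by positivity), one_div,
    ← Real.rpow_neg hk₀.le]
  linarith [div_neg_of_neg_of_pos hD₀ hk₀]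

theorem isBigO_log (h : IsWindowContraction e N 1 c) (hN : 0 < N) (hc : 0 ≤ c)
    (he : ∀ k, 0 ≤ e k) : e =O[atTop] fun k : ℕ => Real.log k / (k : ℝ) := by
  have hN' : (0 : ℝ) < N := by exact_mod_cast hN
  have hsuper : ∀ᶠ k : ℕ in atTop, (1 - 1 * N / k) * (4 * c / N * (Real.log k / k))
      + c / (k : ℝ) ^ 2 ≤ 4 * c / N * (Real.log ((k + N : ℕ) : ℝ) / ((k + N : ℕ) : ℝ)) := by
    filter_upwards [eventually_ge_atTop 1, eventually_ge_atTop N] with k hk hNk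
    have : (0 : ℝ) < k := by exact_mod_cast hk
    have hstep := one_sub_mul_log_div_add_le hN' (k := k) (by exact_mod_cast hNk)
      (by exact_mod_cast hk)
    push_cast
    calc _ = 4 * c / N * ((1 - N / k) * (Real.log k / k) + N / (4 * k ^ 2)) := by
          field_simp
      _ ≤ _ := by gcongr
  obtain ⟨b, hb, hle⟩ := exists_le_mul_add_of_supersolution hN
    (eventually_one_sub_div_nonneg (1 * N)) h
    (eventually_natCast_pos.mono fun k hk => Real.rpow_pos_of_pos hk _)
    (eventually_one_sub_mul_rpow_neg_le zero_le_one N) hsuper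
  have hlog : Tendsto (fun k : ℕ => Real.log (k : ℝ)) atTop atTop :=
    Real.tendsto_log_atTop.comp tendsto_natCast_atTop_atTop
  refine Asymptotics.IsBigO.of_bound (b + 4 * c / N) ?_
  filter_upwards [hle, hlog.eventually_ge_atTop 1] with k hk hlogk
  rw [Real.norm_of_nonneg (he k), Real.norm_of_nonneg (by positivity)]
  calc e k ≤ b * (k : ℝ) ^ (-1 : ℝ) + 4 * c / N * (Real.log k / k) := hk
    _ = b * (1 / k) + 4 * c / N * (Real.log k / k) := by rw [Real.rpow_neg_one, one_div]
    _ ≤ b * (Real.log k / k) + 4 * c / N * (Real.log k / k) := by gcongr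
    _ = (b + 4 * c / N) * (Real.log k / k) := by ring

end IsWindowContraction

theorem le_rpow_mul_add_of_window_contraction {u : ℕ → ℝ} {N m : ℕ} {q E : ℝ} (hq : 0 ≤ q)
    (hu : 0 ≤ u m) (hE : 0 ≤ E)
    (h : ∀ k : ℕ, m ≤ k → 0 ≤ 1 - q * N / (k + 1) ∧ u (k + N) ≤ (1 - q * N / (k + 1)) * u k + E)
    (i : ℕ) :
    u (m + i * N) ≤ u m * ((m : ℝ) + 1) ^ q * (((m + i * N : ℕ) : ℝ) + 1) ^ (-q) + i * E := by
  induction i with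
  | zero =>
    rw [Real.rpow_neg (by positivity)]
    simp [mul_assoc, mul_inv_cancel₀ (Real.rpow_pos_of_pos (by positivity : (0 : ℝ) < m + 1) q).ne']
  | succ i ih =>
    rw [show m + (i + 1) * N = m + i * N + N by ring]
    generalize hk : m + i * N = k at ih ⊢
    obtain ⟨hnonneg, hstep⟩ := h k (by omega)
    have hpow : (1 - q * N / (k + 1)) * ((k : ℝ) + 1) ^ (-q) ≤ (((k + N : ℕ) : ℝ) + 1) ^ (-q) := by
      convert one_sub_mul_rpow_neg_le hq (by positivity : (0 : ℝ) < k + 1) N.cast_nonneg using 2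
      push_cast
      ring
    have hdrop : (1 - q * N / ((k : ℝ) + 1)) * (i * E) ≤ i * E :=
      mul_le_of_le_one_left (by positivity) (sub_le_self _ (by positivity))
    calc u (k + N)
        ≤ (1 - q * N / (k + 1)) *
            (u m * ((m : ℝ) + 1) ^ q * ((k : ℝ) + 1) ^ (-q) + i * E) + E :=
          hstep.trans (by gcongr)
      _ = u m * ((m : ℝ) + 1) ^ q * ((1 - q * N / (k + 1)) * ((k : ℝ) + 1) ^ (-q))
            + (1 - q * N / (k + 1)) * (i * E) + E := by ring
      _ ≤ u m * ((m : ℝ) + 1) ^ q * (((k + N : ℕ) : ℝ) + 1) ^ (-q) + i * E + E := by gcongr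
      _ = u m * ((m : ℝ) + 1) ^ q * (((k + N : ℕ) : ℝ) + 1) ^ (-q) + ((i + 1 : ℕ) : ℝ) * E := by
          push_cast
          ring

end WindowContraction

section HarmonicSteps

variable {E : Type*} [NormedAddCommGroup E] {x : ℕ → E} {D : ℝ}

theorem norm_add_sub_le_of_harmonic_steps (hD : 0 ≤ D)
    (hx : ∀ k : ℕ, ‖x (k + 1) - x k‖ ≤ D / (k + 1)) (k i : ℕ) :
    ‖x (k + i) - x k‖ ≤ i * (D / (k + 1)) := by
  rw [← dist_eq_norm, dist_comm]
  calc dist (x k) (x (k + i)) ≤ ∑ j ∈ Finset.Ico k (k + i), dist (x j) (x (j + 1)) :=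
        dist_le_Ico_sum_dist x (Nat.le_add_right k i)
    _ ≤ ∑ _j ∈ Finset.Ico k (k + i), D / ((k : ℝ) + 1) := by
        refine Finset.sum_le_sum fun j hj => ?_
        rw [dist_comm, dist_eq_norm]
        have : (k : ℝ) ≤ j := by exact_mod_cast (Finset.mem_Ico.1 hj).1
        exact (hx j).trans (by gcongr)
    _ = i * (D / (k + 1)) := by simp

theorem norm_le_log_of_harmonic_steps (hD : 0 ≤ D)
    (hx : ∀ k : ℕ, ‖x (k + 1) - x k‖ ≤ D / (k + 1)) (k : ℕ) :
    ‖x k‖ ≤ ‖x 0‖ + D * (1 + Real.log k) := by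
  have hharm : ‖x k‖ ≤ ‖x 0‖ + D * (harmonic k : ℝ) := by
    induction k with
    | zero => simp
    | succ k ih =>
      have hsucc : (harmonic (k + 1) : ℝ) = (harmonic k : ℝ) + ((k : ℝ) + 1)⁻¹ := by
        rw [harmonic_succ]
        push_cast
        ring
      have htri : ‖x (k + 1)‖ ≤ ‖x k‖ + ‖x (k + 1) - x k‖ := norm_le_norm_add_norm_sub' _ _
      have := hx k
      rw [hsucc, mul_add, ← div_eq_mul_inv]
      linarith
  exact hharm.trans (by gcongr; exact harmonic_le_one_add_log k)

end HarmonicSteps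

section NormFunctions

variable {E : Type*} [NormedAddCommGroup E]

/-- The smooth approximation `√(1 + ‖v‖²)` of the norm, whose exponential moments control tails. -/
noncomputable def smoothNorm (v : E) : ℝ := √(1 + ‖v‖ ^ 2)

theorem sq_smoothNorm (v : E) : smoothNorm v ^ 2 = 1 + ‖v‖ ^ 2 := Real.sq_sqrt (by positivity)

theorem one_le_smoothNorm (v : E) : 1 ≤ smoothNorm v :=
  Real.one_le_sqrt.2 (le_add_of_nonneg_right (by positivity))

theorem smoothNorm_pos (v : E) : 0 < smoothNorm v := one_pos.trans_le (one_le_smoothNorm v)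

theorem norm_le_smoothNorm (v : E) : ‖v‖ ≤ smoothNorm v := Real.le_sqrt_of_sq_le (by linarith)

theorem smoothNorm_le (v : E) : smoothNorm v ≤ 1 + ‖v‖ :=
  Real.sqrt_le_iff.2 ⟨by positivity, by linarith [norm_nonneg v]⟩

theorem continuous_smoothNorm : Continuous (smoothNorm (E := E)) := by
  unfold smoothNorm
  fun_prop

theorem smoothNorm_add_le (v w : E) : smoothNorm (v + w) ≤ smoothNorm v + ‖w‖ := by
  refine Real.sqrt_le_iff.2 ⟨add_nonneg (smoothNorm_pos v).le (norm_nonneg w), ?_⟩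
  have hsq : ‖v + w‖ ^ 2 ≤ (‖v‖ + ‖w‖) ^ 2 := by
    gcongr
    exact norm_add_le v w
  have hcross := mul_le_mul_of_nonneg_right (norm_le_smoothNorm v) (norm_nonneg w)
  linarith [sq_smoothNorm v]

theorem smoothNorm_le_add_norm_sub (v w : E) : smoothNorm v ≤ smoothNorm w + ‖v - w‖ := by
  simpa using smoothNorm_add_le w (v - w)

theorem abs_smoothNorm_sub_le (v w : E) : |smoothNorm v - smoothNorm w| ≤ ‖v - w‖ :=
  abs_sub_le_iff.2 ⟨by linarith [smoothNorm_le_add_norm_sub v w], by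
    linarith [smoothNorm_le_add_norm_sub w v, norm_sub_rev v w]⟩

theorem continuous_exp_smoothNorm (l : ℝ) :
    Continuous fun v : E => Real.exp (l * smoothNorm v) := by
  have := continuous_smoothNorm (E := E)
  fun_prop

/-- The Lyapunov function `‖v‖² + B ‖v‖³`. Its cubic term adds `3 B ‖v‖ / 2` to the relative drift,
which absorbs the error of a Lipschitz density away from the origin. -/
noncomputable def cubicLyapunov (B : ℝ) (v : E) : ℝ := ‖v‖ ^ 2 + B * ‖v‖ ^ 3

theorem cubicLyapunov_nonneg {B : ℝ} (hB : 0 ≤ B) (v : E) : 0 ≤ cubicLyapunov B v := by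
  unfold cubicLyapunov
  positivity

theorem sq_norm_le_cubicLyapunov {B : ℝ} (hB : 0 ≤ B) (v : E) : ‖v‖ ^ 2 ≤ cubicLyapunov B v :=
  le_add_of_nonneg_right (by positivity)

end NormFunctions

section RadialMajorant

variable {E : Type*} [NormedAddCommGroup E] [InnerProductSpace ℝ E]

/-- A second order upper bound for increments of norm at most `s` of a test function `W` whose
gradient is radial: `q v • v` is the gradient at `v`, and `κ v` bounds the quadratic term. -/
structure RadialMajorant (W q κ : E → ℝ) (s : ℝ) : Prop where
  continuous : Continuous W
  continuous_slope : Continuous q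
  continuous_curvature : Continuous κ
  curvature_nonneg : ∀ v, 0 ≤ κ v
  add_le : ∀ v w, ‖w‖ ≤ s → W (v + w) ≤ W v + q v * inner ℝ v w + κ v * ‖w‖ ^ 2

theorem RadialMajorant.mono {W q κ : E → ℝ} {s t : ℝ} (h : RadialMajorant W q κ s) (hts : t ≤ s) :
    RadialMajorant W q κ t where
  __ := h
  add_le v w hw := h.add_le v w (hw.trans hts)

theorem smoothNorm_add_le_inner (v w : E) :
    smoothNorm (v + w) ≤ smoothNorm v + inner ℝ v w / smoothNorm v + ‖w‖ ^ 2 / 2 := by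
  have hpos := smoothNorm_pos v
  have hexpand : smoothNorm (v + w) ^ 2 = smoothNorm v ^ 2 + 2 * inner ℝ v w + ‖w‖ ^ 2 := by
    rw [sq_smoothNorm, sq_smoothNorm, norm_add_sq_real]
    ring
  calc smoothNorm (v + w)
      ≤ (smoothNorm v ^ 2 + smoothNorm (v + w) ^ 2) / (2 * smoothNorm v) := by
        rw [le_div_iff₀ (by positivity)]
        linarith [two_mul_le_add_sq (smoothNorm v) (smoothNorm (v + w))]
    _ = smoothNorm v + inner ℝ v w / smoothNorm v + ‖w‖ ^ 2 / (2 * smoothNorm v) := by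
        rw [hexpand]
        field_simp
        ring
    _ ≤ smoothNorm v + inner ℝ v w / smoothNorm v + ‖w‖ ^ 2 / 2 := by
        gcongr
        linarith [one_le_smoothNorm v]

theorem exp_smoothNorm_add_le {l : ℝ} (hl : 1 ≤ l) {v w : E} (hw : l * ‖w‖ ≤ 1) :
    Real.exp (l * smoothNorm (v + w)) ≤ Real.exp (l * smoothNorm v)
      + Real.exp (l * smoothNorm v) * (l / smoothNorm v) * inner ℝ v w
      + 2 * l ^ 2 * Real.exp (l * smoothNorm v) * ‖w‖ ^ 2 := by
  have hl₀ : 0 ≤ l := by linarith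
  set y := l * (smoothNorm (v + w) - smoothNorm v) with hy
  have habs : |y| ≤ l * ‖w‖ := by
    rw [hy, abs_mul, abs_of_nonneg hl₀]
    gcongr
    simpa using abs_smoothNorm_sub_le (v + w) v
  have hsq : y ^ 2 ≤ (l * ‖w‖) ^ 2 := sq_le_sq' (abs_le.1 habs).1 (abs_le.1 habs).2
  have hexp := (abs_le.1 (Real.abs_exp_sub_one_sub_id_le (habs.trans hw))).2
  have hlin := mul_le_mul_of_nonneg_left (smoothNorm_add_le_inner v w) hl₀
  have hquad : l * ‖w‖ ^ 2 ≤ l ^ 2 * ‖w‖ ^ 2 := by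
    gcongr
    exact le_self_pow₀ hl two_ne_zero
  have hfactor : Real.exp y ≤ 1 + l / smoothNorm v * inner ℝ v w + 2 * l ^ 2 * ‖w‖ ^ 2 := by
    have : l * (inner ℝ v w / smoothNorm v) = l / smoothNorm v * inner ℝ v w := by ring
    linarith [mul_pow l ‖w‖ 2, sq_nonneg (l * ‖w‖)]
  calc Real.exp (l * smoothNorm (v + w)) = Real.exp (l * smoothNorm v) * Real.exp y := by
        rw [← Real.exp_add, hy]
        ring_nf
    _ ≤ Real.exp (l * smoothNorm v)
        * (1 + l / smoothNorm v * inner ℝ v w + 2 * l ^ 2 * ‖w‖ ^ 2) := by gcongr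
    _ = _ := by ring

theorem radialMajorant_exp_smoothNorm {l s : ℝ} (hl : 1 ≤ l) (hs : l * s ≤ 1) :
    RadialMajorant (E := E) (fun v => Real.exp (l * smoothNorm v))
      (fun v => Real.exp (l * smoothNorm v) * (l / smoothNorm v))
      (fun v => 2 * l ^ 2 * Real.exp (l * smoothNorm v)) s where
  continuous := continuous_exp_smoothNorm l
  continuous_slope := (continuous_exp_smoothNorm l).mul
    (continuous_const.div continuous_smoothNorm fun v => (smoothNorm_pos v).ne')
  continuous_curvature := continuous_const.mul (continuous_exp_smoothNorm l)
  curvature_nonneg v := by positivity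
  add_le v w hw := exp_smoothNorm_add_le hl <|
    (mul_le_mul_of_nonneg_left hw (by linarith)).trans hs

theorem norm_add_cube_le (v w : E) :
    ‖v + w‖ ^ 3 ≤ ‖v‖ ^ 3 + 3 * ‖v‖ * inner ℝ v w + (3 * ‖v‖ + ‖w‖) * ‖w‖ ^ 2 := by
  have hsq : ‖v + w‖ ^ 2 = ‖v‖ ^ 2 + 2 * inner ℝ v w + ‖w‖ ^ 2 := norm_add_sq_real v w
  have hdiff : (‖v + w‖ - ‖v‖) ^ 2 ≤ ‖w‖ ^ 2 :=
    sq_le_sq.2 (by simpa using abs_norm_sub_norm_le (v + w) v)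
  calc ‖v + w‖ ^ 3
      = (‖v + w‖ - ‖v‖) ^ 2 * (‖v + w‖ + ‖v‖ / 2) + 3 * ‖v‖ / 2 * ‖v + w‖ ^ 2
          - ‖v‖ ^ 3 / 2 := by ring
    _ ≤ ‖w‖ ^ 2 * (‖v‖ + ‖w‖ + ‖v‖ / 2) + 3 * ‖v‖ / 2 * ‖v + w‖ ^ 2 - ‖v‖ ^ 3 / 2 := by
        gcongr
        exact norm_add_le v w
    _ = ‖v‖ ^ 3 + 3 * ‖v‖ * inner ℝ v w + (3 * ‖v‖ + ‖w‖) * ‖w‖ ^ 2 := by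
        rw [hsq]
        ring

theorem radialMajorant_cubicLyapunov {B s : ℝ} (hB : 0 ≤ B) (hs : 0 ≤ s) :
    RadialMajorant (E := E) (cubicLyapunov B) (fun v => 2 + 3 * B * ‖v‖)
      (fun v => 1 + B * (3 * ‖v‖ + s)) s where
  continuous := by
    unfold cubicLyapunov
    fun_prop
  continuous_slope := by fun_prop
  continuous_curvature := by fun_prop
  curvature_nonneg v := by positivity
  add_le v w hw := by
    have hcube := mul_le_mul_of_nonneg_left (norm_add_cube_le v w) hB
    have hthird : B * (‖w‖ * ‖w‖ ^ 2) ≤ B * (s * ‖w‖ ^ 2) := by gcongr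
    unfold cubicLyapunov
    rw [norm_add_sq_real]
    linarith

theorem abs_inner_le_mul_norm {p : E} {M : ℝ} (hp : ‖p‖ ≤ M) (v : E) :
    |inner ℝ p v| ≤ M * ‖v‖ :=
  (abs_real_inner_le_norm p v).trans (by gcongr)

theorem sq_inner_le {p v : E} {M R : ℝ} (hp : ‖p‖ ≤ M) (hv : ‖v‖ ≤ R) :
    (inner ℝ p v : ℝ) ^ 2 ≤ (M * R) ^ 2 := by
  have hM : 0 ≤ M := (norm_nonneg p).trans hp
  exact sq_le_sq' (by linarith [neg_le_of_abs_le (abs_inner_le_mul_norm hp v),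
    mul_le_mul_of_nonneg_left hv hM]) ((le_of_abs_le (abs_inner_le_mul_norm hp v)).trans
      (by gcongr))

theorem sq_inner_sub_sq_inner_le {p v w : E} {M R : ℝ} (hp : ‖p‖ ≤ M) (hv : ‖v‖ ≤ R)
    (hw : ‖w‖ ≤ R) :
    (inner ℝ p v : ℝ) ^ 2 - (inner ℝ p w : ℝ) ^ 2 ≤ 2 * R * M ^ 2 * ‖v - w‖ := by
  have hM : 0 ≤ M := (norm_nonneg p).trans hp
  have hfactor : (inner ℝ p v : ℝ) ^ 2 - (inner ℝ p w : ℝ) ^ 2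
      = inner ℝ p (v - w) * inner ℝ p (v + w) := by
    rw [inner_sub_right, inner_add_right]
    ring
  calc (inner ℝ p v : ℝ) ^ 2 - (inner ℝ p w : ℝ) ^ 2
      ≤ |inner ℝ p (v - w)| * |inner ℝ p (v + w)| := by
        rw [hfactor, ← abs_mul]
        exact le_abs_self _
    _ ≤ (M * ‖v - w‖) * (M * (R + R)) := by
        gcongr
        · exact abs_inner_le_mul_norm hp _
        · exact (abs_inner_le_mul_norm hp _).trans (by gcongr; exact norm_add_le_of_le hv hw)
    _ = 2 * R * M ^ 2 * ‖v - w‖ := by ring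

theorem weighted_sq_inner_sub_le {B M R : ℝ} (hB : 0 ≤ B) {p v w : E} (hp : ‖p‖ ≤ M)
    (hv : ‖v‖ ≤ R) (hw : ‖w‖ ≤ R) :
    (1 + B * ‖v‖) * (inner ℝ p v : ℝ) ^ 2 - (2 * R + 3 * B * R ^ 2) * M ^ 2 * ‖v - w‖
      ≤ (1 + B * ‖w‖) * (inner ℝ p w : ℝ) ^ 2 := by
  have hR : 0 ≤ R := (norm_nonneg v).trans hv
  have hsquares : (1 + B * ‖v‖) * ((inner ℝ p v : ℝ) ^ 2 - (inner ℝ p w : ℝ) ^ 2)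
      ≤ (1 + B * R) * (2 * R * M ^ 2 * ‖v - w‖) := by
    grw [sq_inner_sub_sq_inner_le hp hv hw, hv]
  have hweights : B * (‖v‖ - ‖w‖) * (inner ℝ p w : ℝ) ^ 2 ≤ B * ‖v - w‖ * (M * R) ^ 2 := by
    have := sq_inner_le hp hw
    gcongr
    exact norm_sub_norm_le v w
  linarith

end RadialMajorant

section StochasticRecursion

variable {E : Type*} [NormedAddCommGroup E] [InnerProductSpace ℝ E]

/-- A stochastic approximation recursion
`x (k+1) = x k + (β / (k+1)) (ξ (k+1) - g (k+1) ⟪φ (k+1), x k⟫) φ (k+1)` with gains `β / (k+1)`,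
bounded and persistently exciting regressors, increments bounded by the gain, martingale difference
noise `ξ` and a restoring force `g`. The values `φ 0`, `g 0`, `ξ 0` are irrelevant. -/
structure StochasticRecursion {Ω : Type*} {mΩ : MeasurableSpace Ω} (P : Measure Ω)
    (ℱ : Filtration ℕ mΩ) (φ : ℕ → E) (M β δ : ℝ) (N : ℕ) (g : ℕ → ℝ → ℝ) (x₀ : E)
    (x : ℕ → Ω → E) (ξ : ℕ → Ω → ℝ) : Prop where
  gain_pos : 0 < β
  level_pos : 0 < δ
  window_pos : 0 < N
  norm_regressor_le : ∀ k, ‖φ (k + 1)‖ ≤ M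
  excitation : ∀ k v, N * δ * ‖v‖ ^ 2 ≤ ∑ i ∈ Finset.range N, (inner ℝ (φ (k + i + 1)) v : ℝ) ^ 2
  init : ∀ ω, x 0 ω = x₀
  recursion : ∀ k ω, x (k + 1) ω = x k ω +
    (β / ((k : ℝ) + 1) * (ξ (k + 1) ω - g (k + 1) (inner ℝ (φ (k + 1)) (x k ω)))) • φ (k + 1)
  abs_innovation_le : ∀ k ω, |ξ (k + 1) ω - g (k + 1) (inner ℝ (φ (k + 1)) (x k ω))| ≤ 1
  noise_adapted : ∀ k, StronglyMeasurable[ℱ (k + 1)] (ξ (k + 1))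
  noise_integrable : ∀ k, Integrable (ξ (k + 1)) P
  condExp_noise : ∀ k, P[ξ (k + 1) | ℱ k] =ᵐ[P] 0
  force_continuous : ∀ k, Continuous (g (k + 1))
  force_nonneg : ∀ k u, 0 ≤ u * g (k + 1) u
  force_lower : ∀ r, 0 < r → ∃ c, 0 < c ∧ ∀ k u, r ≤ |u| → c * |u| ≤ u * g (k + 1) u

/-- The inner product of `v` with the mean increment at time `k`, up to the factor
`-β / (k + 1)`. -/
noncomputable def recursionDrift (φ : ℕ → E) (g : ℕ → ℝ → ℝ) (k : ℕ) (v : E) : ℝ :=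
  inner ℝ (φ (k + 1)) v * g (k + 1) (inner ℝ (φ (k + 1)) v)

/-- The bound on the mean change, in step `k` from `v`, of a test function with radial slope `q` and
curvature `κ`. -/
noncomputable def stepChange (φ : ℕ → E) (g : ℕ → ℝ → ℝ) (M β : ℝ) (q κ : E → ℝ) (k : ℕ)
    (v : E) : ℝ :=
  κ v * (β * M / (k + 1)) ^ 2 - β / (k + 1) * (q v * recursionDrift φ g k v)

end StochasticRecursion

namespace StochasticRecursion

variable {E : Type*} [NormedAddCommGroup E] [InnerProductSpace ℝ E] {Ω : Type*}
  {mΩ : MeasurableSpace Ω} {P : Measure Ω} {ℱ : Filtration ℕ mΩ} {φ : ℕ → E} {M β δ : ℝ} {N : ℕ}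
  {g : ℕ → ℝ → ℝ} {x₀ : E} {x : ℕ → Ω → E} {ξ : ℕ → Ω → ℝ}

theorem bound_nonneg (h : StochasticRecursion P ℱ φ M β δ N g x₀ x ξ) : 0 ≤ M :=
  (norm_nonneg _).trans (h.norm_regressor_le 0)

theorem gain_mul_bound_nonneg (h : StochasticRecursion P ℱ φ M β δ N g x₀ x ξ) : 0 ≤ β * M :=
  mul_nonneg h.gain_pos.le h.bound_nonneg

theorem norm_succ_sub_le (h : StochasticRecursion P ℱ φ M β δ N g x₀ x ξ) (k : ℕ) (ω : Ω) :
    ‖x (k + 1) ω - x k ω‖ ≤ β * M / (k + 1) := by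
  have := h.gain_pos
  rw [h.recursion k ω, add_sub_cancel_left, norm_smul, Real.norm_eq_abs, abs_mul,
    abs_of_nonneg (by positivity)]
  calc β / ((k : ℝ) + 1) * |ξ (k + 1) ω - g (k + 1) (inner ℝ (φ (k + 1)) (x k ω))| * ‖φ (k + 1)‖
      ≤ β / ((k : ℝ) + 1) * 1 * M := by
        gcongr
        · exact h.abs_innovation_le k ω
        · exact h.norm_regressor_le k
    _ = β * M / (k + 1) := by ring

theorem norm_add_sub_le (h : StochasticRecursion P ℱ φ M β δ N g x₀ x ξ) (k i : ℕ) (ω : Ω) :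
    ‖x (k + i) ω - x k ω‖ ≤ i * (β * M / (k + 1)) :=
  norm_add_sub_le_of_harmonic_steps (x := fun k => x k ω) h.gain_mul_bound_nonneg
    (fun k => h.norm_succ_sub_le k ω) k i

theorem norm_le_log (h : StochasticRecursion P ℱ φ M β δ N g x₀ x ξ) (k : ℕ) (ω : Ω) :
    ‖x k ω‖ ≤ ‖x₀‖ + β * M * (1 + Real.log k) := by
  simpa only [h.init] using norm_le_log_of_harmonic_steps (x := fun k => x k ω)
    h.gain_mul_bound_nonneg (fun k => h.norm_succ_sub_le k ω) k

theorem stronglyAdapted (h : StochasticRecursion P ℱ φ M β δ N g x₀ x ξ) :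
    StronglyAdapted ℱ x := by
  intro k
  induction k with
  | zero =>
    rw [show x 0 = fun _ => x₀ from funext h.init]
    exact stronglyMeasurable_const
  | succ k ih =>
    have hx : StronglyMeasurable[ℱ (k + 1)] (x k) := ih.mono (ℱ.mono (Nat.le_succ k))
    have hforce : Continuous fun v => g (k + 1) (inner ℝ (φ (k + 1)) v) :=
      (h.force_continuous k).comp (by fun_prop)
    rw [show x (k + 1) = _ from funext (h.recursion k)]
    exact hx.add ((((h.noise_adapted k).sub (hforce.comp_stronglyMeasurable hx)).const_mul
      _).smul_const _)

theorem continuous_drift (h : StochasticRecursion P ℱ φ M β δ N g x₀ x ξ) (k : ℕ) :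
    Continuous (recursionDrift φ g k) := by
  have := h.force_continuous k
  unfold recursionDrift
  fun_prop

theorem drift_nonneg (h : StochasticRecursion P ℱ φ M β δ N g x₀ x ξ) (k : ℕ) (v : E) :
    0 ≤ recursionDrift φ g k v := h.force_nonneg k _

theorem continuous_stepChange (h : StochasticRecursion P ℱ φ M β δ N g x₀ x ξ) {W q κ : E → ℝ}
    {s : ℝ} (hW : RadialMajorant W q κ s) (k : ℕ) :
    Continuous (stepChange φ g M β q κ k) := by
  have := h.continuous_drift k
  have := hW.continuous_slope
  have := hW.continuous_curvature
  unfold stepChange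
  fun_prop

theorem le_add_stepChange_add_noise (h : StochasticRecursion P ℱ φ M β δ N g x₀ x ξ) {k : ℕ}
    {W q κ : E → ℝ} (hW : RadialMajorant W q κ (β * M / (k + 1))) (ω : Ω) :
    W (x (k + 1) ω) ≤ W (x k ω) + stepChange φ g M β q κ k (x k ω)
      + β / (k + 1) * (q (x k ω) * inner ℝ (φ (k + 1)) (x k ω) * ξ (k + 1) ω) := by
  have hnorm := h.norm_succ_sub_le k ω
  have hstep := hW.add_le (x k ω) _ hnorm
  have hinner : inner ℝ (x k ω) (x (k + 1) ω - x k ω) = β / ((k : ℝ) + 1) *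
      (ξ (k + 1) ω - g (k + 1) (inner ℝ (φ (k + 1)) (x k ω))) * inner ℝ (φ (k + 1)) (x k ω) := by
    rw [h.recursion k ω, add_sub_cancel_left, inner_smul_right, real_inner_comm]
  have hcurv : κ (x k ω) * ‖x (k + 1) ω - x k ω‖ ^ 2 ≤ κ (x k ω) * (β * M / (k + 1)) ^ 2 := by
    have := hW.curvature_nonneg (x k ω)
    gcongr
  rw [add_sub_cancel, hinner] at hstep
  unfold stepChange recursionDrift
  linarith

section Integration

variable [ProperSpace E]

theorem exists_abs_comp_le (h : StochasticRecursion P ℱ φ M β δ N g x₀ x ξ) (k : ℕ) {G : E → ℝ}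
    (hG : Continuous G) : ∃ c, ∀ ω, ‖G (x k ω)‖ ≤ c := by
  obtain ⟨c, hc⟩ := (isCompact_closedBall (0 : E)
    (‖x₀‖ + β * M * (1 + Real.log k))).exists_bound_of_continuousOn hG.continuousOn
  exact ⟨c, fun ω => hc _ (by simpa using h.norm_le_log k ω)⟩

variable [IsFiniteMeasure P]

theorem integrable_comp (h : StochasticRecursion P ℱ φ M β δ N g x₀ x ξ) (k : ℕ) {G : E → ℝ}
    (hG : Continuous G) : Integrable (fun ω => G (x k ω)) P := by
  obtain ⟨c, hc⟩ := h.exists_abs_comp_le k hG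
  exact Integrable.of_bound (hG.comp_stronglyMeasurable
    ((h.stronglyAdapted k).mono (ℱ.le k))).aestronglyMeasurable c (ae_of_all P hc)

theorem integrable_mul_noise (h : StochasticRecursion P ℱ φ M β δ N g x₀ x ξ) (k : ℕ) {G : E → ℝ}
    (hG : Continuous G) : Integrable (fun ω => G (x k ω) * ξ (k + 1) ω) P := by
  obtain ⟨c, hc⟩ := h.exists_abs_comp_le k hG
  exact (h.noise_integrable k).bdd_mul (h.integrable_comp k hG).aestronglyMeasurable
    (ae_of_all P hc)

theorem setIntegral_mul_noise_eq_zero (h : StochasticRecursion P ℱ φ M β δ N g x₀ x ξ) (k : ℕ)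
    {G : E → ℝ} (hG : Continuous G) {A : Set Ω} (hA : MeasurableSet[ℱ k] A) :
    ∫ ω in A, G (x k ω) * ξ (k + 1) ω ∂P = 0 := by
  have hcond : P[fun ω => G (x k ω) * ξ (k + 1) ω | ℱ k] =ᵐ[P] 0 := by
    filter_upwards [condExp_mul_of_stronglyMeasurable_left
      (hG.comp_stronglyMeasurable (h.stronglyAdapted k)) (h.integrable_mul_noise k hG)
      (h.noise_integrable k), h.condExp_noise k] with ω hpull hzero
    exact hpull.trans (by simp [hzero])
  rw [← setIntegral_condExp (ℱ.le k) (h.integrable_mul_noise k hG) hA,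
    integral_congr_ae (ae_restrict_of_ae hcond)]
  simp

theorem setIntegral_succ_le (h : StochasticRecursion P ℱ φ M β δ N g x₀ x ξ) {k : ℕ}
    {W q κ : E → ℝ} (hW : RadialMajorant W q κ (β * M / (k + 1))) {A : Set Ω}
    (hA : MeasurableSet[ℱ k] A) :
    ∫ ω in A, W (x (k + 1) ω) ∂P
      ≤ ∫ ω in A, (W (x k ω) + stepChange φ g M β q κ k (x k ω)) ∂P := by
  have hG : Continuous fun v => q v * inner ℝ (φ (k + 1)) v := by
    have := hW.continuous_slope
    fun_prop
  have hmean : Integrable (fun ω => W (x k ω) + stepChange φ g M β q κ k (x k ω)) P :=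
    h.integrable_comp k (hW.continuous.add (h.continuous_stepChange hW k))
  have hnoise := (h.integrable_mul_noise k hG).const_mul (β / (k + 1))
  calc ∫ ω in A, W (x (k + 1) ω) ∂P
      ≤ ∫ ω in A, (W (x k ω) + stepChange φ g M β q κ k (x k ω)
          + β / (k + 1) * (q (x k ω) * inner ℝ (φ (k + 1)) (x k ω) * ξ (k + 1) ω)) ∂P :=
        setIntegral_mono (h.integrable_comp (k + 1) hW.continuous).integrableOn
          (hmean.add hnoise).integrableOn (h.le_add_stepChange_add_noise hW)
    _ = ∫ ω in A, (W (x k ω) + stepChange φ g M β q κ k (x k ω)) ∂P := by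
        rw [integral_add hmean.integrableOn hnoise.integrableOn, integral_const_mul,
          h.setIntegral_mul_noise_eq_zero k hG hA, mul_zero, add_zero]

theorem setIntegral_add_le (h : StochasticRecursion P ℱ φ M β δ N g x₀ x ξ) {k : ℕ}
    {W q κ : E → ℝ} (hW : RadialMajorant W q κ (β * M / (k + 1))) {A : Set Ω}
    (hA : MeasurableSet[ℱ k] A) (i : ℕ) :
    ∫ ω in A, W (x (k + i) ω) ∂P ≤ ∫ ω in A, (W (x k ω) +
      ∑ j ∈ Finset.range i, stepChange φ g M β q κ (k + j) (x (k + j) ω)) ∂P := by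
  have hstep : ∀ j, Integrable (fun ω => stepChange φ g M β q κ (k + j) (x (k + j) ω)) P :=
    fun j => h.integrable_comp (k + j) (h.continuous_stepChange hW (k + j))
  induction i with
  | zero => simp
  | succ i ih =>
    have hle : β * M / (((k + i : ℕ) : ℝ) + 1) ≤ β * M / (k + 1) := by
      have := h.gain_mul_bound_nonneg
      gcongr
      exact Nat.le_add_right k i
    have hlast := h.setIntegral_succ_le (hW.mono hle) (ℱ.mono (Nat.le_add_right k i) _ hA)
    rw [integral_add (h.integrable_comp _ hW.continuous).integrableOn
      (hstep i).integrableOn] at hlast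
    have hsum : Integrable (fun ω => W (x k ω) +
        ∑ j ∈ Finset.range i, stepChange φ g M β q κ (k + j) (x (k + j) ω)) P :=
      (h.integrable_comp k hW.continuous).add (integrable_finsetSum _ fun j _ => hstep j)
    simp_rw [Finset.sum_range_succ, ← add_assoc]
    rw [integral_add hsum.integrableOn (hstep i).integrableOn]
    exact hlast.trans (by gcongr)

end Integration

section Probability

variable [ProperSpace E] [IsProbabilityMeasure P]

theorem integral_add_window_le (h : StochasticRecursion P ℱ φ M β δ N g x₀ x ξ) {k i : ℕ}
    {W q κ : E → ℝ} (hW : RadialMajorant W q κ (β * M / (k + 1))) (hW₀ : ∀ v, 0 ≤ W v) {A : Set Ω}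
    (hA : MeasurableSet[ℱ k] A) {a b e : ℝ} (ha : a ≤ 1) (hb : 0 ≤ b)
    (hin : ∀ ω ∈ A, W (x k ω) + ∑ j ∈ Finset.range i, stepChange φ g M β q κ (k + j) (x (k + j) ω)
      ≤ (1 - a) * W (x k ω) + b)
    (hout : ∫ ω in Aᶜ, W (x (k + i) ω) ∂P ≤ e) :
    ∫ ω, W (x (k + i) ω) ∂P ≤ (1 - a) * ∫ ω, W (x k ω) ∂P + b + e := by
  have hA' : MeasurableSet A := ℱ.le k _ hA
  have hWk := h.integrable_comp k hW.continuous
  have hbound : Integrable (fun ω => (1 - a) * W (x k ω) + b) P :=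
    (hWk.const_mul _).add (integrable_const b)
  have hsum : Integrable (fun ω => W (x k ω) +
      ∑ j ∈ Finset.range i, stepChange φ g M β q κ (k + j) (x (k + j) ω)) P :=
    hWk.add (integrable_finsetSum _ fun j _ =>
      h.integrable_comp (k + j) (h.continuous_stepChange hW (k + j)))
  have hmain : ∫ ω in A, W (x (k + i) ω) ∂P ≤ (1 - a) * ∫ ω, W (x k ω) ∂P + b := calc
    ∫ ω in A, W (x (k + i) ω) ∂P
      ≤ ∫ ω in A, ((1 - a) * W (x k ω) + b) ∂P := (h.setIntegral_add_le hW hA i).trans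
        (setIntegral_mono_on hsum.integrableOn hbound.integrableOn hA' hin)
    _ ≤ ∫ ω, ((1 - a) * W (x k ω) + b) ∂P := setIntegral_le_integral hbound <|
        ae_of_all P fun ω => add_nonneg (mul_nonneg (sub_nonneg.2 ha) (hW₀ _)) hb
    _ = (1 - a) * ∫ ω, W (x k ω) ∂P + b := by
        rw [integral_add (hWk.const_mul _) (integrable_const b), integral_const_mul]
        simp
  rw [← integral_add_compl hA' (h.integrable_comp (k + i) hW.continuous)]
  exact add_le_add hmain hout

end Probability

end StochasticRecursion

namespace StochasticRecursion

variable {E : Type*} [NormedAddCommGroup E] [InnerProductSpace ℝ E] {Ω : Type*}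
  {mΩ : MeasurableSpace Ω} {P : Measure Ω} {ℱ : Filtration ℕ mΩ} {φ : ℕ → E} {M β δ : ℝ} {N : ℕ}
  {g : ℕ → ℝ → ℝ} {x₀ : E} {x : ℕ → Ω → E} {ξ : ℕ → Ω → ℝ}

theorem measurableSet_norm_ge (h : StochasticRecursion P ℱ φ M β δ N g x₀ x ξ) (r : ℝ) (k : ℕ) :
    MeasurableSet[ℱ k] {ω | r ≤ ‖x k ω‖} :=
  measurableSet_le measurable_const (h.stronglyAdapted k).norm.measurable

theorem exists_le_abs_inner (h : StochasticRecursion P ℱ φ M β δ N g x₀ x ξ) (k : ℕ) (v : E) :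
    ∃ j < N, √δ * ‖v‖ ≤ |inner ℝ (φ (k + j + 1)) v| := by
  by_contra! hcon
  have hlt : ∑ i ∈ Finset.range N, (inner ℝ (φ (k + i + 1)) v : ℝ) ^ 2
      < ∑ _i ∈ Finset.range N, δ * ‖v‖ ^ 2 := by
    refine Finset.sum_lt_sum_of_nonempty (Finset.nonempty_range_iff.2 h.window_pos.ne')
      fun i hi => ?_
    rw [← sq_abs, ← Real.sq_sqrt h.level_pos.le, ← mul_pow]
    exact pow_lt_pow_left₀ (hcon i (Finset.mem_range.1 hi)) (abs_nonneg _) two_ne_zero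
  rw [Finset.sum_const, Finset.card_range, nsmul_eq_mul, ← mul_assoc] at hlt
  exact hlt.not_ge (h.excitation k v)

theorem norm_window_sub_le (h : StochasticRecursion P ℱ φ M β δ N g x₀ x ξ) (k : ℕ) {j : ℕ}
    (hj : j ≤ N) (ω : Ω) : ‖x (k + j) ω - x k ω‖ ≤ N * (β * M / (k + 1)) := by
  refine (h.norm_add_sub_le k j ω).trans ?_
  have := h.gain_mul_bound_nonneg
  gcongr

theorem abs_inner_window_sub_le (h : StochasticRecursion P ℱ φ M β δ N g x₀ x ξ) (k : ℕ) {j : ℕ}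
    (hj : j ≤ N) (ω : Ω) : |inner ℝ (φ (k + j + 1)) (x k ω)|
      ≤ |inner ℝ (φ (k + j + 1)) (x (k + j) ω)| + M * (N * (β * M / (k + 1))) := by
  have hM := h.bound_nonneg
  rw [← sub_le_iff_le_add']
  calc |inner ℝ (φ (k + j + 1)) (x k ω)| - |inner ℝ (φ (k + j + 1)) (x (k + j) ω)|
      ≤ |inner ℝ (φ (k + j + 1)) (x (k + j) ω - x k ω)| := by
        rw [inner_sub_right, abs_sub_comm]
        exact abs_sub_abs_le_abs_sub _ _
    _ ≤ M * ‖x (k + j) ω - x k ω‖ := abs_inner_le_mul_norm (h.norm_regressor_le _) _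
    _ ≤ M * (N * (β * M / (k + 1))) := by
        gcongr
        exact h.norm_window_sub_le k hj ω

theorem exists_drift_ge (h : StochasticRecursion P ℱ φ M β δ N g x₀ x ξ) {r : ℝ} (hr : 0 < r) :
    ∃ c, 0 < c ∧ ∀ᶠ k : ℕ in atTop, ∀ ω, r ≤ ‖x k ω‖ →
      ∃ j < N, c * ‖x k ω‖ ≤ recursionDrift φ g (k + j) (x (k + j) ω) := by
  have hδ : 0 < √δ := Real.sqrt_pos.2 h.level_pos
  obtain ⟨c, hc, hforce⟩ := h.force_lower (√δ * r / 2) (by positivity)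
  have hlim : Tendsto (fun k : ℕ => M * (N * (β * M / ((k : ℝ) + 1)))) atTop (𝓝 0) := by
    have := (tendsto_one_div_add_atTop_nhds_zero_nat (𝕜 := ℝ)).const_mul (M * (N * (β * M)))
    rw [mul_zero] at this
    exact this.congr fun k => by ring
  refine ⟨c * (√δ / 2), by positivity, ?_⟩
  filter_upwards [hlim.eventually_le_const (show 0 < √δ * r / 2 by positivity)] with k hk ω hω
  obtain ⟨j, hj, hjk⟩ := h.exists_le_abs_inner k (x k ω)
  refine ⟨j, hj, ?_⟩
  have hnorm : √δ * r ≤ √δ * ‖x k ω‖ := by gcongr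
  have hmove := h.abs_inner_window_sub_le k hj.le ω
  have hinner : √δ / 2 * ‖x k ω‖ ≤ |inner ℝ (φ (k + j + 1)) (x (k + j) ω)| := by linarith
  calc c * (√δ / 2) * ‖x k ω‖ = c * (√δ / 2 * ‖x k ω‖) := by ring
    _ ≤ c * |inner ℝ (φ (k + j + 1)) (x (k + j) ω)| := by gcongr
    _ ≤ recursionDrift φ g (k + j) (x (k + j) ω) := hforce (k + j) _ (by linarith)

section ExponentialMoments

variable {k j : ℕ} {l : ℝ}

theorem abs_mul_smoothNorm_window_sub_le (h : StochasticRecursion P ℱ φ M β δ N g x₀ x ξ)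
    (hl : 0 ≤ l) (hlk : l * (N * (β * M / (k + 1))) ≤ 1) (hj : j ≤ N) (ω : Ω) :
    |l * smoothNorm (x (k + j) ω) - l * smoothNorm (x k ω)| ≤ 1 := by
  rw [← mul_sub, abs_mul, abs_of_nonneg hl]
  refine le_trans ?_ hlk
  gcongr
  exact (abs_smoothNorm_sub_le _ _).trans (h.norm_window_sub_le k hj ω)

theorem exp_smoothNorm_window_le (h : StochasticRecursion P ℱ φ M β δ N g x₀ x ξ) (hl : 0 ≤ l)
    (hlk : l * (N * (β * M / (k + 1))) ≤ 1) (hj : j ≤ N) (ω : Ω) :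
    Real.exp (l * smoothNorm (x (k + j) ω)) ≤ Real.exp 1 * Real.exp (l * smoothNorm (x k ω)) := by
  rw [← Real.exp_add, Real.exp_le_exp]
  linarith [(abs_sub_le_iff.1 (h.abs_mul_smoothNorm_window_sub_le hl hlk hj ω)).1]

theorem exp_smoothNorm_div_le_window (h : StochasticRecursion P ℱ φ M β δ N g x₀ x ξ)
    (hl : 0 ≤ l) (hlk : l * (N * (β * M / (k + 1))) ≤ 1) (hj : j ≤ N) (ω : Ω) :
    Real.exp (l * smoothNorm (x k ω)) / Real.exp 1 ≤ Real.exp (l * smoothNorm (x (k + j) ω)) := by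
  rw [← Real.exp_sub, Real.exp_le_exp]
  linarith [(abs_sub_le_iff.1 (h.abs_mul_smoothNorm_window_sub_le hl hlk hj ω)).2]

theorem smoothNorm_window_le (h : StochasticRecursion P ℱ φ M β δ N g x₀ x ξ) (hl : 1 ≤ l)
    (hlk : l * (N * (β * M / (k + 1))) ≤ 1) (hj : j ≤ N) (ω : Ω) :
    smoothNorm (x (k + j) ω) ≤ 2 + ‖x k ω‖ := by
  have hβM := h.gain_mul_bound_nonneg
  have hone : N * (β * M / ((k : ℝ) + 1)) ≤ 1 :=
    (le_mul_of_one_le_left (by positivity) hl).trans hlk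
  linarith [smoothNorm_le_add_norm_sub (x (k + j) ω) (x k ω), smoothNorm_le (x k ω),
    h.norm_window_sub_le k hj ω]

theorem exp_curvature_window_le (h : StochasticRecursion P ℱ φ M β δ N g x₀ x ξ) (hl : 0 ≤ l)
    (hlk : l * (N * (β * M / (k + 1))) ≤ 1) (hj : j ≤ N) (ω : Ω) :
    2 * l ^ 2 * Real.exp (l * smoothNorm (x (k + j) ω)) * (β * M / ((k + j : ℕ) + 1)) ^ 2
      ≤ 2 * Real.exp 1 * (β * M) ^ 2 * (l / (k + 1)) ^ 2 * Real.exp (l * smoothNorm (x k ω)) := by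
  have hβM := h.gain_mul_bound_nonneg
  calc 2 * l ^ 2 * Real.exp (l * smoothNorm (x (k + j) ω)) * (β * M / ((k + j : ℕ) + 1)) ^ 2
      ≤ 2 * l ^ 2 * (Real.exp 1 * Real.exp (l * smoothNorm (x k ω))) * (β * M / (k + 1)) ^ 2 := by
        gcongr
        · exact h.exp_smoothNorm_window_le hl hlk hj ω
        · exact Nat.le_add_right k j
    _ = 2 * Real.exp 1 * (β * M) ^ 2 * (l / (k + 1)) ^ 2
          * Real.exp (l * smoothNorm (x k ω)) := by ring

theorem exp_drift_nonneg (h : StochasticRecursion P ℱ φ M β δ N g x₀ x ξ) (hl : 0 ≤ l) (k : ℕ)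
    (v : E) : 0 ≤ β / ((k : ℝ) + 1) *
      (Real.exp (l * smoothNorm v) * (l / smoothNorm v) * recursionDrift φ g k v) := by
  have := h.gain_pos
  have := h.drift_nonneg k v
  have := smoothNorm_pos v
  positivity

theorem exp_drift_window_ge (h : StochasticRecursion P ℱ φ M β δ N g x₀ x ξ) (hl : 1 ≤ l)
    (hlk : l * (N * (β * M / (k + 1))) ≤ 1) (hj : j < N) {ω : Ω} {r c : ℝ} (hr : 0 < r)
    (hc : 0 ≤ c) (hω : r ≤ ‖x k ω‖)
    (hdrift : c * ‖x k ω‖ ≤ recursionDrift φ g (k + j) (x (k + j) ω)) :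
    β * c * (r / (2 + r)) / (Real.exp 1 * N) * (l / (k + 1)) * Real.exp (l * smoothNorm (x k ω))
      ≤ β / ((k + j : ℕ) + 1) * (Real.exp (l * smoothNorm (x (k + j) ω)) *
        (l / smoothNorm (x (k + j) ω)) * recursionDrift φ g (k + j) (x (k + j) ω)) := by
  have hβ := h.gain_pos
  have hl₀ : 0 < l := by linarith
  have hsmooth := smoothNorm_pos (x (k + j) ω)
  have hgain : ((k + j : ℕ) : ℝ) + 1 ≤ N * (k + 1) := by
    have hjN : (j : ℝ) + 1 ≤ N := by exact_mod_cast hj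
    push_cast
    nlinarith [Nat.cast_nonneg (α := ℝ) k, Nat.cast_nonneg (α := ℝ) j]
  have hratio : r / (2 + r) ≤ ‖x k ω‖ / (2 + ‖x k ω‖) := by
    rw [div_le_div_iff₀ (by positivity) (by positivity)]
    linarith
  calc β * c * (r / (2 + r)) / (Real.exp 1 * N) * (l / (k + 1)) * Real.exp (l * smoothNorm (x k ω))
      = β / (N * (k + 1)) *
          (Real.exp (l * smoothNorm (x k ω)) / Real.exp 1 * (l * (c * (r / (2 + r))))) := by
        field_simp
    _ ≤ β / (N * (k + 1)) * (Real.exp (l * smoothNorm (x k ω)) / Real.exp 1 *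
          (l * (c * (‖x k ω‖ / (2 + ‖x k ω‖))))) := by gcongr
    _ = β / (N * (k + 1)) * (Real.exp (l * smoothNorm (x k ω)) / Real.exp 1 *
          (l / (2 + ‖x k ω‖)) * (c * ‖x k ω‖)) := by field_simp
    _ ≤ β / ((k + j : ℕ) + 1) * (Real.exp (l * smoothNorm (x (k + j) ω)) *
          (l / smoothNorm (x (k + j) ω)) * recursionDrift φ g (k + j) (x (k + j) ω)) := by
        gcongr
        · exact h.exp_smoothNorm_div_le_window hl₀.le hlk hj.le ω
        · exact h.smoothNorm_window_le hl hlk hj.le ω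

theorem exp_add_sum_stepChange_le (h : StochasticRecursion P ℱ φ M β δ N g x₀ x ξ) (hl : 1 ≤ l)
    (hlk : l * (N * (β * M / (k + 1))) ≤ 1) (hj : j < N) {ω : Ω} {r c : ℝ} (hr : 0 < r)
    (hc : 0 ≤ c) (hω : r ≤ ‖x k ω‖)
    (hdrift : c * ‖x k ω‖ ≤ recursionDrift φ g (k + j) (x (k + j) ω)) :
    Real.exp (l * smoothNorm (x k ω)) + ∑ i ∈ Finset.range N,
        stepChange φ g M β (fun v => Real.exp (l * smoothNorm v) * (l / smoothNorm v))
          (fun v => 2 * l ^ 2 * Real.exp (l * smoothNorm v)) (k + i) (x (k + i) ω)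
      ≤ (1 - (β * c * (r / (2 + r)) / (Real.exp 1 * N) * (l / (k + 1))
          - N * (2 * Real.exp 1 * (β * M) ^ 2) * (l / (k + 1)) ^ 2))
        * Real.exp (l * smoothNorm (x k ω)) := by
  have hl₀ : 0 ≤ l := by linarith
  have hcurvature := Finset.sum_le_card_nsmul (Finset.range N) _ _ fun i hi =>
    h.exp_curvature_window_le hl₀ hlk (Finset.mem_range.1 hi).le ω
  have hsingle := (h.exp_drift_window_ge hl hlk hj hr hc hω hdrift).trans
    (Finset.single_le_sum (f := fun i => β / (((k + i : ℕ) : ℝ) + 1) *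
      (Real.exp (l * smoothNorm (x (k + i) ω)) * (l / smoothNorm (x (k + i) ω)) *
        recursionDrift φ g (k + i) (x (k + i) ω)))
      (fun i _ => h.exp_drift_nonneg hl₀ (k + i) _) (Finset.mem_range.2 hj))
  rw [Finset.card_range, nsmul_eq_mul] at hcurvature
  simp only [stepChange, Finset.sum_sub_distrib]
  linarith

end ExponentialMoments

end StochasticRecursion

theorem exists_forall_half_mul_le_sub_sq {a b D : ℝ} (ha : 0 < a) (hb : 0 ≤ b) (hD : 0 ≤ D) :
    ∃ c, 0 < c ∧ ∀ t, 0 ≤ t → t ≤ c →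
      a / 2 * t ≤ a * t - b * t ^ 2 ∧ a / 2 * t ≤ 1 ∧ t * D ≤ 1 := by
  refine ⟨a / (2 * b + a ^ 2 + a * D), by positivity, fun t ht htc => ?_⟩
  rw [le_div_iff₀ (by positivity)] at htc
  have hbt : 0 ≤ t * b := by positivity
  have : 0 ≤ t * a := by positivity
  have hDt : 0 ≤ t * D := by positivity
  refine ⟨?_, ?_, ?_⟩
  · have hlin : b * t ≤ a / 2 := by nlinarith
    nlinarith
  · nlinarith
  · nlinarith

theorem eventually_exists_window_start (N : ℕ) (hN : 0 < N) {α : ℝ} (hα₀ : 0 < α) (hα₁ : α ≤ 1) :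
    ∀ᶠ k : ℕ in atTop, ∃ m i : ℕ, m + i * N = k ∧ i ≤ k ∧ (k : ℝ) ^ α ≤ m ∧
      Real.log (m + 1) ≤ α * Real.log (k + 1) + Real.log (N + 3) := by
  filter_upwards [eventually_ge_atTop 1] with k hk
  have hk₁ : (1 : ℝ) ≤ k := by exact_mod_cast hk
  set m₀ := ⌈(k : ℝ) ^ α⌉₊
  have hm₀k : m₀ ≤ k := Nat.ceil_le.2 (Real.rpow_le_self_of_one_le hk₁ hα₁)
  have hmod := (Nat.mod_lt (k - m₀) hN).le
  refine ⟨m₀ + (k - m₀) % N, (k - m₀) / N, ?_, (Nat.div_le_self _ _).trans (Nat.sub_le _ _),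
    (Nat.le_ceil _).trans (by exact_mod_cast Nat.le_add_right m₀ _), ?_⟩
  · rw [add_assoc, Nat.mod_add_div' (k - m₀) N]
    omega
  · rw [← Real.log_rpow (by positivity), ← Real.log_mul (by positivity) (by positivity)]
    refine Real.log_le_log (by positivity) ?_
    have hceil : (m₀ : ℝ) < (k : ℝ) ^ α + 1 := Nat.ceil_lt_add_one (by positivity)
    have hmono : (k : ℝ) ^ α ≤ ((k : ℝ) + 1) ^ α := by
      gcongr
      linarith
    have hone : 1 ≤ ((k : ℝ) + 1) ^ α := Real.one_le_rpow (by linarith) hα₀.le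
    have hmod' : (((k - m₀) % N : ℕ) : ℝ) ≤ N := by exact_mod_cast hmod
    push_cast
    nlinarith [Nat.cast_nonneg (α := ℝ) N]

theorem tendsto_natCast_rpow_atTop {α : ℝ} (hα : 0 < α) :
    Tendsto (fun k : ℕ => (k : ℝ) ^ α) atTop atTop :=
  (tendsto_rpow_atTop hα).comp tendsto_natCast_atTop_atTop

theorem exists_exponent_eventually_add_mul_log_le {a D : ℝ} (ha : 0 < a) (hD : 0 ≤ D) (b c : ℝ) :
    ∃ α, 0 < α ∧ α ≤ 1 ∧ ∀ᶠ k : ℕ in atTop,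
      b + D * (α * Real.log (k + 1) + c) ≤ a * Real.log (k + 1) := by
  have hlog : Tendsto (fun k : ℕ => Real.log ((k : ℝ) + 1)) atTop atTop :=
    Real.tendsto_log_atTop.comp (tendsto_atTop_add_const_right _ 1 tendsto_natCast_atTop_atTop)
  have hDα : D * (a / (2 * (D + a))) ≤ a / 2 := by
    rw [mul_div_assoc', div_le_div_iff₀ (by positivity) (by positivity)]
    nlinarith
  refine ⟨a / (2 * (D + a)), by positivity, (div_le_one (by positivity)).2 (by linarith), ?_⟩
  filter_upwards [hlog.eventually_ge_atTop 0,
    (hlog.const_mul_atTop (half_pos ha)).eventually_ge_atTop (b + D * c)] with k hnonneg hdecay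
  linarith [mul_le_mul_of_nonneg_right hDα hnonneg]

namespace StochasticRecursion

variable {E : Type*} [NormedAddCommGroup E] [InnerProductSpace ℝ E] {Ω : Type*}
  {mΩ : MeasurableSpace Ω} {P : Measure Ω} {ℱ : Filtration ℕ mΩ} {φ : ℕ → E} {M β δ : ℝ} {N : ℕ}
  {g : ℕ → ℝ → ℝ} {x₀ : E} {x : ℕ → Ω → E} {ξ : ℕ → Ω → ℝ}

section Tail

variable [ProperSpace E] [IsProbabilityMeasure P]

theorem setIntegral_exp_smoothNorm_compl_le (h : StochasticRecursion P ℱ φ M β δ N g x₀ x ξ)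
    {k : ℕ} {l : ℝ} (hl : 0 ≤ l) (hlk : l * (N * (β * M / (k + 1))) ≤ 1) (r : ℝ) :
    ∫ ω in {ω | r ≤ ‖x k ω‖}ᶜ, Real.exp (l * smoothNorm (x (k + N) ω)) ∂P
      ≤ Real.exp 1 * Real.exp (l * √(1 + r ^ 2)) := by
  have hmeas := (ℱ.le k _ (h.measurableSet_norm_ge r k)).compl
  calc ∫ ω in {ω | r ≤ ‖x k ω‖}ᶜ, Real.exp (l * smoothNorm (x (k + N) ω)) ∂P
      ≤ ∫ _ω in {ω | r ≤ ‖x k ω‖}ᶜ, Real.exp 1 * Real.exp (l * √(1 + r ^ 2)) ∂P := by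
        refine setIntegral_mono_on (h.integrable_comp _ (continuous_exp_smoothNorm l)).integrableOn
          (integrable_const _).integrableOn hmeas fun ω hω => ?_
        have hnorm : ‖x k ω‖ ≤ r := (not_le.1 (show ¬r ≤ ‖x k ω‖ from hω)).le
        refine (h.exp_smoothNorm_window_le hl hlk le_rfl ω).trans ?_
        unfold smoothNorm
        gcongr
    _ ≤ Real.exp 1 * Real.exp (l * √(1 + r ^ 2)) := by
        rw [setIntegral_const, smul_eq_mul]
        exact mul_le_of_le_one_left (by positivity) measureReal_le_one

theorem exists_exp_moment_contraction (h : StochasticRecursion P ℱ φ M β δ N g x₀ x ξ) {r : ℝ}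
    (hr : 0 < r) : ∃ a c : ℝ, 0 < a ∧ 0 < c ∧ ∀ᶠ k : ℕ in atTop, ∀ l : ℝ, 1 ≤ l → l ≤ c * (k + 1) →
      0 ≤ 1 - a * l * N / (k + 1) ∧
      ∫ ω, Real.exp (l * smoothNorm (x (k + N) ω)) ∂P ≤
        (1 - a * l * N / (k + 1)) * ∫ ω, Real.exp (l * smoothNorm (x k ω)) ∂P
          + Real.exp 1 * Real.exp (l * √(1 + r ^ 2)) := by
  have hN : (0 : ℝ) < N := by exact_mod_cast h.window_pos
  have hβ := h.gain_pos
  have hβM := h.gain_mul_bound_nonneg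
  obtain ⟨c₀, hc₀, hdrift⟩ := h.exists_drift_ge hr
  set a₀ := β * c₀ * (r / (2 + r)) / (Real.exp 1 * N)
  have ha₀ : 0 < a₀ := by positivity
  obtain ⟨c, hc, hsmall⟩ := exists_forall_half_mul_le_sub_sq ha₀
    (show 0 ≤ N * (2 * Real.exp 1 * (β * M) ^ 2) by positivity)
    (show 0 ≤ N * (β * M) by positivity)
  refine ⟨a₀ / (2 * N), c, by positivity, hc, ?_⟩
  filter_upwards [hdrift] with k hk l hl hlc
  have hl₀ : 0 ≤ l := by linarith
  obtain ⟨hquad, hone, hlk⟩ := hsmall (l / (k + 1)) (by positivity)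
    ((div_le_iff₀ (by positivity)).2 hlc)
  replace hlk : l * (N * (β * M / (k + 1))) ≤ 1 := by
    convert hlk using 1
    ring
  have hrate : a₀ / (2 * N) * l * N / (k + 1) = a₀ / 2 * (l / (k + 1)) := by field_simp
  rw [hrate]
  refine ⟨sub_nonneg.2 hone, ?_⟩
  have hN₁ : (1 : ℝ) ≤ N := by exact_mod_cast h.window_pos
  have hW := radialMajorant_exp_smoothNorm (E := E) hl
    ((mul_le_mul_of_nonneg_left (le_mul_of_one_le_left (by positivity) hN₁) hl₀).trans hlk)
  have hwindow := h.integral_add_window_le (i := N) hW (fun v => (Real.exp_pos _).le)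
    (h.measurableSet_norm_ge r k) hone le_rfl (fun ω hω => ?_)
    (h.setIntegral_exp_smoothNorm_compl_le hl₀ hlk r)
  · rwa [add_zero] at hwindow
  · obtain ⟨j, hj, hjk⟩ := hk ω hω
    refine (h.exp_add_sum_stepChange_le hl hlk hj hr hc₀.le hω hjk).trans ?_
    rw [add_zero]
    gcongr

theorem integral_exp_smoothNorm_le (h : StochasticRecursion P ℱ φ M β δ N g x₀ x ξ) {l : ℝ}
    (hl : 0 ≤ l) (m : ℕ) : ∫ ω, Real.exp (l * smoothNorm (x m ω)) ∂P
      ≤ Real.exp (l * (1 + (‖x₀‖ + β * M * (1 + Real.log (m + 1))))) := by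
  have hβM := h.gain_mul_bound_nonneg
  have hlog : Real.log m ≤ Real.log (m + 1) := by
    rcases Nat.eq_zero_or_pos m with rfl | hm
    · simp
    · exact Real.log_le_log (by exact_mod_cast hm) (by linarith)
  have hpoint : ∀ ω, Real.exp (l * smoothNorm (x m ω))
      ≤ Real.exp (l * (1 + (‖x₀‖ + β * M * (1 + Real.log (m + 1))))) := fun ω => by
    gcongr
    refine (smoothNorm_le _).trans ?_
    grw [h.norm_le_log m ω, hlog]
  simpa using integral_mono (h.integrable_comp m (continuous_exp_smoothNorm l))
    (integrable_const _) hpoint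

theorem integral_exp_smoothNorm_add_mul_le (h : StochasticRecursion P ℱ φ M β δ N g x₀ x ξ)
    {a l e : ℝ} {m : ℕ} (ha : 0 ≤ a) (hl : 0 ≤ l) (he : 0 ≤ e)
    (hcontr : ∀ k : ℕ, m ≤ k → 0 ≤ 1 - a * l * N / (k + 1) ∧
      ∫ ω, Real.exp (l * smoothNorm (x (k + N) ω)) ∂P ≤
        (1 - a * l * N / (k + 1)) * ∫ ω, Real.exp (l * smoothNorm (x k ω)) ∂P + e) (i : ℕ) :
    ∫ ω, Real.exp (l * smoothNorm (x (m + i * N) ω)) ∂P ≤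
      Real.exp (l * (1 + (‖x₀‖ + β * M * (1 + Real.log (m + 1))) + a * Real.log (m + 1)
        - a * Real.log ((m + i * N : ℕ) + 1))) + i * e := by
  refine (le_rpow_mul_add_of_window_contraction (u := fun k =>
    ∫ ω, Real.exp (l * smoothNorm (x k ω)) ∂P) (by positivity)
    (integral_nonneg fun ω => (Real.exp_pos _).le) he hcontr i).trans ?_
  grw [h.integral_exp_smoothNorm_le hl m]
  rw [Real.rpow_def_of_pos (by positivity), Real.rpow_def_of_pos (by positivity), ← Real.exp_add,
    ← Real.exp_add]
  apply le_of_eq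
  congr 2
  ring

theorem measureReal_norm_ge_le (h : StochasticRecursion P ℱ φ M β δ N g x₀ x ξ) {l ρ : ℝ}
    (hl : 0 ≤ l) (hρ : 0 ≤ ρ) (k : ℕ) : P.real {ω | ρ ≤ ‖x k ω‖} ≤
      Real.exp (-(l * √(1 + ρ ^ 2))) * ∫ ω, Real.exp (l * smoothNorm (x k ω)) ∂P := by
  have hmarkov := mul_meas_ge_le_integral_of_nonneg (μ := P)
    (f := fun ω => Real.exp (l * smoothNorm (x k ω))) (ae_of_all P fun ω => (Real.exp_pos _).le)
    (h.integrable_comp k (continuous_exp_smoothNorm l)) (Real.exp (l * √(1 + ρ ^ 2)))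
  rw [Real.exp_neg, ← div_eq_inv_mul, le_div_iff₀ (Real.exp_pos _), mul_comm]
  refine (mul_le_mul_of_nonneg_left (measureReal_mono fun ω (hω : ρ ≤ ‖x k ω‖) => ?_)
    (Real.exp_pos _).le).trans hmarkov
  change Real.exp (l * √(1 + ρ ^ 2)) ≤ Real.exp (l * √(1 + ‖x k ω‖ ^ 2))
  gcongr

theorem eventually_exists_integral_exp_smoothNorm_le
    (h : StochasticRecursion P ℱ φ M β δ N g x₀ x ξ) {r : ℝ} (hr : 0 < r) :
    ∃ α c : ℝ, 0 < α ∧ 0 < c ∧ ∀ᶠ k : ℕ in atTop, ∃ l, 0 ≤ l ∧ c * (k : ℝ) ^ α ≤ l ∧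
      ∫ ω, Real.exp (l * smoothNorm (x k ω)) ∂P
        ≤ (1 + 3 * k) * Real.exp (l * √(1 + r ^ 2)) := by
  obtain ⟨a, c, ha, hc, hev⟩ := h.exists_exp_moment_contraction hr
  obtain ⟨k₀, hk₀⟩ := eventually_atTop.1 hev
  have hβM := h.gain_mul_bound_nonneg
  -- Starting the windows at `m ≈ k ^ α` makes the logarithmic growth up to time `m` negligible
  -- against the decay `a log k` accumulated afterwards.
  obtain ⟨α, hα₀, hα₁, hgrowth⟩ := exists_exponent_eventually_add_mul_log_le ha
    (show 0 ≤ β * M + a by positivity) (1 + (‖x₀‖ + β * M)) (Real.log (N + 3))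
  have hpow := tendsto_natCast_rpow_atTop hα₀
  refine ⟨α, c, hα₀, hc, ?_⟩
  filter_upwards [eventually_exists_window_start N h.window_pos hα₀ hα₁, hgrowth,
    hpow.eventually_ge_atTop (k₀ : ℝ), hpow.eventually_ge_atTop (1 / c)]
    with k ⟨m, i, hmi, hi, hm, hmlog⟩ hgrowth hstart hlevel
  have hlevel' : 1 ≤ c * ((m : ℝ) + 1) := by
    rw [div_le_iff₀' hc] at hlevel
    nlinarith
  have hl₀ : 0 ≤ c * ((m : ℝ) + 1) := by positivity
  refine ⟨c * (m + 1), hl₀, by gcongr; linarith, ?_⟩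
  have hmoment := h.integral_exp_smoothNorm_add_mul_le (m := m)
    (e := Real.exp 1 * Real.exp (c * (m + 1) * √(1 + r ^ 2))) ha.le hl₀ (by positivity)
    (fun k hk => hk₀ k ((Nat.cast_le.1 (hstart.trans hm)).trans hk) _ hlevel' (by gcongr)) i
  rw [hmi] at hmoment
  have hexponent : 1 + (‖x₀‖ + β * M * (1 + Real.log (m + 1))) + a * Real.log (m + 1)
      - a * Real.log (k + 1) ≤ √(1 + r ^ 2) := by
    have hstartlog := mul_le_mul_of_nonneg_left hmlog (show 0 ≤ β * M + a by positivity)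
    linarith [Real.sqrt_nonneg (1 + r ^ 2)]
  grw [hmoment, hexponent, Real.exp_one_lt_three, hi]
  exact le_of_eq (by ring)

theorem exists_eventually_tail_le_exp (h : StochasticRecursion P ℱ φ M β δ N g x₀ x ξ) {ρ : ℝ}
    (hρ : 0 < ρ) : ∃ α b : ℝ, 0 < α ∧ 0 < b ∧ ∀ᶠ k : ℕ in atTop,
      P.real {ω | ρ ≤ ‖x k ω‖} ≤ (1 + 3 * k) * Real.exp (-b * (k : ℝ) ^ α) := by
  obtain ⟨α, c, hα, hc, hev⟩ := h.eventually_exists_integral_exp_smoothNorm_le (half_pos hρ)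
  have hgap : 0 < √(1 + ρ ^ 2) - √(1 + (ρ / 2) ^ 2) :=
    sub_pos.2 (Real.sqrt_lt_sqrt (by positivity) (by nlinarith))
  refine ⟨α, c * (√(1 + ρ ^ 2) - √(1 + (ρ / 2) ^ 2)), hα, by positivity, ?_⟩
  filter_upwards [hev] with k ⟨l, hl, hkl, hmoment⟩
  calc P.real {ω | ρ ≤ ‖x k ω‖}
      ≤ Real.exp (-(l * √(1 + ρ ^ 2)))
          * ((1 + 3 * k) * Real.exp (l * √(1 + (ρ / 2) ^ 2))) := by
        grw [h.measureReal_norm_ge_le hl hρ.le k, hmoment]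
    _ = (1 + 3 * k) * Real.exp (-(l * (√(1 + ρ ^ 2) - √(1 + (ρ / 2) ^ 2)))) := by
        rw [mul_left_comm, ← Real.exp_add]
        congr 2
        ring
    _ ≤ (1 + 3 * k) * Real.exp (-(c * (√(1 + ρ ^ 2) - √(1 + (ρ / 2) ^ 2))) * (k : ℝ) ^ α) := by
        gcongr
        linarith [mul_le_mul_of_nonneg_right hkl hgap.le]

theorem eventually_tail_mul_pow_le (h : StochasticRecursion P ℱ φ M β δ N g x₀ x ξ) {ρ : ℝ}
    (hρ : 0 < ρ) (p : ℕ) :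
    ∀ᶠ k : ℕ in atTop, P.real {ω | ρ ≤ ‖x k ω‖} * (k : ℝ) ^ p ≤ 1 := by
  obtain ⟨α, b, hα, hb, hev⟩ := h.exists_eventually_tail_le_exp hρ
  have hexp := ((isLittleO_exp_neg_mul_rpow_atTop hb (-((p + 1) / α))).comp_tendsto
    (tendsto_natCast_rpow_atTop hα)).bound (show (0 : ℝ) < 1 / 4 by norm_num)
  filter_upwards [hev, hexp, eventually_ge_atTop 1] with k htail hk hk₁
  have hk₁' : (1 : ℝ) ≤ k := by exact_mod_cast hk₁
  have hk₀ : (0 : ℝ) < k := by linarith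
  simp only [Function.comp_apply, Real.norm_eq_abs, Real.abs_exp] at hk
  rw [← Real.rpow_mul hk₀.le, abs_of_nonneg (by positivity),
    show α * -(((p : ℝ) + 1) / α) = -((p + 1 : ℕ) : ℝ) by push_cast; field_simp,
    Real.rpow_neg hk₀.le, Real.rpow_natCast] at hk
  calc P.real {ω | ρ ≤ ‖x k ω‖} * (k : ℝ) ^ p
      ≤ (1 + 3 * k) * (1 / 4 * ((k : ℝ) ^ (p + 1))⁻¹) * (k : ℝ) ^ p := by grw [htail, hk]
    _ ≤ (4 * k) * (1 / 4 * ((k : ℝ) ^ (p + 1))⁻¹) * (k : ℝ) ^ p := by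
        gcongr
        linarith
    _ = 1 := by
        rw [pow_succ]
        field_simp

end Tail

end StochasticRecursion

namespace StochasticRecursion

variable {E : Type*} [NormedAddCommGroup E] [InnerProductSpace ℝ E] {Ω : Type*}
  {mΩ : MeasurableSpace Ω} {P : Measure Ω} {ℱ : Filtration ℕ mΩ} {φ : ℕ → E} {M β δ : ℝ} {N : ℕ}
  {g : ℕ → ℝ → ℝ} {x₀ : E} {x : ℕ → Ω → E} {ξ : ℕ → Ω → ℝ}

section CubicLyapunov

variable {f' B : ℝ}

theorem exists_weighted_drift_ge (h : StochasticRecursion P ℱ φ M β δ N g x₀ x ξ) {L ρ : ℝ}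
    (hf' : 0 < f') (hL : 0 ≤ L) (hρ : 0 < ρ)
    (hloc : ∀ k u, |u| ≤ ρ → (f' - L * |u|) * u ^ 2 ≤ u * g (k + 1) u) :
    ∃ B r : ℝ, 0 ≤ B ∧ 0 < r ∧ r ≤ 1 ∧ ∀ k v, ‖v‖ ≤ r →
      2 * f' * ((1 + B * ‖v‖) * (inner ℝ (φ (k + 1)) v : ℝ) ^ 2)
        ≤ (2 + 3 * B * ‖v‖) * recursionDrift φ g k v := by
  have hM := h.bound_nonneg
  obtain ⟨B, hB, hBf⟩ : ∃ B, 0 ≤ B ∧ f' * B = 4 * (L * M) :=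
    ⟨4 * (L * M) / f', by positivity, by field_simp⟩
  refine ⟨B, min (min (ρ / (M + 1)) (1 / (3 * B + 1))) 1, hB, by positivity, min_le_right _ _,
    fun k v hv => ?_⟩
  obtain ⟨⟨hvρ, hvB⟩, -⟩ : (‖v‖ * (M + 1) ≤ ρ ∧ ‖v‖ * (3 * B + 1) ≤ 1) ∧ ‖v‖ ≤ 1 := by
    rwa [le_min_iff, le_min_iff, le_div_iff₀ (by positivity), le_div_iff₀ (by positivity)] at hv
  have hinner := abs_inner_le_mul_norm (h.norm_regressor_le k) v
  have hdrift : (f' - L * (M * ‖v‖)) * (inner ℝ (φ (k + 1)) v : ℝ) ^ 2 ≤ recursionDrift φ g k v :=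
    le_trans (by gcongr) (hloc k _ (by linarith [norm_nonneg v]))
  have hcubic : 2 * f' * (1 + B * ‖v‖) ≤ (2 + 3 * B * ‖v‖) * (f' - L * (M * ‖v‖)) := by
    have hsmall : 3 * B * ‖v‖ * (L * M * ‖v‖) ≤ 1 * (L * M * ‖v‖) := by
      gcongr
      linarith [norm_nonneg v]
    have hcancel : f' * B * ‖v‖ = 4 * (L * M) * ‖v‖ := by rw [hBf]
    have : 0 ≤ L * M * ‖v‖ := by positivity
    linarith
  calc 2 * f' * ((1 + B * ‖v‖) * (inner ℝ (φ (k + 1)) v : ℝ) ^ 2)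
      = 2 * f' * (1 + B * ‖v‖) * (inner ℝ (φ (k + 1)) v : ℝ) ^ 2 := by ring
    _ ≤ (2 + 3 * B * ‖v‖) * (f' - L * (M * ‖v‖)) * (inner ℝ (φ (k + 1)) v : ℝ) ^ 2 := by gcongr
    _ = (2 + 3 * B * ‖v‖) * ((f' - L * (M * ‖v‖)) * (inner ℝ (φ (k + 1)) v : ℝ) ^ 2) := by ring
    _ ≤ _ := by gcongr

theorem weighted_sq_inner_window_ge (h : StochasticRecursion P ℱ φ M β δ N g x₀ x ξ)
    (hB : 0 ≤ B) {k j : ℕ} (hk : 0 < k) (hj : j ≤ N) {ω : Ω} (hv : ‖x k ω‖ ≤ 1)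
    (hw : ‖x (k + j) ω‖ ≤ 1) :
    (1 + B * ‖x k ω‖) * (inner ℝ (φ (k + j + 1)) (x k ω) : ℝ) ^ 2 / k
        - N * M ^ 2 * ((1 + B) + (2 + 3 * B) * (β * M)) / (k : ℝ) ^ 2
      ≤ (1 + B * ‖x (k + j) ω‖) * (inner ℝ (φ (k + j + 1)) (x (k + j) ω) : ℝ) ^ 2 / (k + N) := by
  have hβM := h.gain_mul_bound_nonneg
  have hk₀ : (0 : ℝ) < k := by exact_mod_cast hk
  set X : ℝ := (1 + B * ‖x k ω‖) * (inner ℝ (φ (k + j + 1)) (x k ω) : ℝ) ^ 2 with hX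
  set Y : ℝ := (2 + 3 * B) * M ^ 2 * (N * (β * M) / k) with hY
  have hX₀ : 0 ≤ X := by positivity
  have hXle : X ≤ (1 + B) * M ^ 2 := by
    have := sq_inner_le (h.norm_regressor_le (k + j)) hv
    rw [mul_one] at this
    grw [hX, this, hv, mul_one]
  have hdist : ‖x k ω - x (k + j) ω‖ ≤ N * (β * M) / k := by
    rw [norm_sub_rev, mul_div_assoc]
    refine (h.norm_window_sub_le k hj ω).trans ?_
    gcongr
    linarith
  have hXY : X - Y ≤ (1 + B * ‖x (k + j) ω‖) * (inner ℝ (φ (k + j + 1)) (x (k + j) ω) : ℝ) ^ 2 := by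
    have := weighted_sq_inner_sub_le hB (h.norm_regressor_le (k + j)) hv hw
    grw [hdist] at this
    linarith
  have hgain : 1 / (k : ℝ) - N / (k : ℝ) ^ 2 ≤ 1 / (k + N) := by
    rw [div_sub_div _ _ hk₀.ne' (by positivity), div_le_div_iff₀ (by positivity) (by positivity)]
    nlinarith [mul_nonneg hk₀.le (sq_nonneg (N : ℝ))]
  calc X / k - N * M ^ 2 * ((1 + B) + (2 + 3 * B) * (β * M)) / (k : ℝ) ^ 2
      = X * (1 / k) - (1 + B) * M ^ 2 * (N / (k : ℝ) ^ 2) - Y * (1 / k) := by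
        rw [hY]
        field_simp
        ring
    _ ≤ X * (1 / k) - X * (N / (k : ℝ) ^ 2) - Y * (1 / (k + N)) := by
        gcongr
        linarith
    _ ≤ X * (1 / (k + N)) - Y * (1 / (k + N)) := by
        gcongr
        linarith [mul_le_mul_of_nonneg_left hgain hX₀]
    _ = (X - Y) / (k + N) := by ring
    _ ≤ _ := by gcongr

theorem gain_mul_drift_window_ge (h : StochasticRecursion P ℱ φ M β δ N g x₀ x ξ) (hf' : 0 ≤ f')
    (hB : 0 ≤ B) {k j : ℕ} (hk : 0 < k) (hj : j < N) {ω : Ω} (hv : ‖x k ω‖ ≤ 1)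
    (hw : ‖x (k + j) ω‖ ≤ 1)
    (hdrift : 2 * f' * ((1 + B * ‖x (k + j) ω‖) * (inner ℝ (φ (k + j + 1)) (x (k + j) ω) : ℝ) ^ 2)
      ≤ (2 + 3 * B * ‖x (k + j) ω‖) * recursionDrift φ g (k + j) (x (k + j) ω)) :
    β * (2 * f' * ((1 + B * ‖x k ω‖) * (inner ℝ (φ (k + j + 1)) (x k ω) : ℝ) ^ 2)) / k
        - 2 * β * f' * N * M ^ 2 * ((1 + B) + (2 + 3 * B) * (β * M)) / (k : ℝ) ^ 2
      ≤ β / ((k + j : ℕ) + 1)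
        * ((2 + 3 * B * ‖x (k + j) ω‖) * recursionDrift φ g (k + j) (x (k + j) ω)) := by
  have hβ := h.gain_pos
  have : (0 : ℝ) < k := by exact_mod_cast hk
  have hwindow := mul_le_mul_of_nonneg_left (h.weighted_sq_inner_window_ge hB hk hj.le hv hw)
    (show 0 ≤ 2 * β * f' by positivity)
  have hdrift₀ := h.drift_nonneg (k + j) (x (k + j) ω)
  have hindex : ((k + j : ℕ) : ℝ) + 1 ≤ k + N := by exact_mod_cast (by omega : k + j + 1 ≤ k + N)
  grw [hindex, ← hdrift]
  refine le_trans (le_of_eq ?_) (hwindow.trans (le_of_eq ?_)) <;> ring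

theorem exists_stepChange_cubicLyapunov_le (h : StochasticRecursion P ℱ φ M β δ N g x₀ x ξ)
    (hf' : 0 ≤ f') (hB : 0 ≤ B) : ∃ c, 0 ≤ c ∧ ∀ k j ω, 0 < k → j < N → ‖x k ω‖ ≤ 1 →
      ‖x (k + j) ω‖ ≤ 1 →
      2 * f' * ((1 + B * ‖x (k + j) ω‖) * (inner ℝ (φ (k + j + 1)) (x (k + j) ω) : ℝ) ^ 2)
        ≤ (2 + 3 * B * ‖x (k + j) ω‖) * recursionDrift φ g (k + j) (x (k + j) ω) →
      stepChange φ g M β (fun v => 2 + 3 * B * ‖v‖) (fun v => 1 + B * (3 * ‖v‖ + β * M)) (k + j)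
          (x (k + j) ω)
        ≤ c / (k : ℝ) ^ 2
          - β * (2 * f' * ((1 + B * ‖x k ω‖) * (inner ℝ (φ (k + j + 1)) (x k ω) : ℝ) ^ 2)) / k := by
  have hβ := h.gain_pos
  have hM := h.bound_nonneg
  refine ⟨(1 + B * (3 + β * M)) * (β * M) ^ 2
    + 2 * β * f' * N * M ^ 2 * ((1 + B) + (2 + 3 * B) * (β * M)), by positivity,
    fun k j ω hk hj hv hw hdrift => ?_⟩
  have : (0 : ℝ) < k := by exact_mod_cast hk
  have hcurv : (1 + B * (3 * ‖x (k + j) ω‖ + β * M)) * (β * M / ((k + j : ℕ) + 1)) ^ 2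
      ≤ (1 + B * (3 + β * M)) * (β * M) ^ 2 / (k : ℝ) ^ 2 := by
    have : (k : ℝ) ≤ (k + j : ℕ) + 1 := by exact_mod_cast (by omega : k ≤ k + j + 1)
    grw [hw, this, mul_one, div_pow, mul_div_assoc]
  have hgain := h.gain_mul_drift_window_ge hf' hB hk hj hv hw hdrift
  unfold stepChange
  rw [add_div]
  linarith

theorem exists_cubicLyapunov_add_sum_stepChange_le
    (h : StochasticRecursion P ℱ φ M β δ N g x₀ x ξ) {r : ℝ} (hf' : 0 ≤ f') (hB : 0 ≤ B)
    (hr : 0 < r) (hr₁ : r ≤ 1) (hdrift : ∀ k v, ‖v‖ ≤ r →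
      2 * f' * ((1 + B * ‖v‖) * (inner ℝ (φ (k + 1)) v : ℝ) ^ 2)
        ≤ (2 + 3 * B * ‖v‖) * recursionDrift φ g k v) :
    ∃ c, 0 ≤ c ∧ ∀ᶠ k : ℕ in atTop, ∀ ω, ‖x k ω‖ < r / 2 →
      cubicLyapunov B (x k ω) + ∑ j ∈ Finset.range N, stepChange φ g M β
          (fun v => 2 + 3 * B * ‖v‖) (fun v => 1 + B * (3 * ‖v‖ + β * M)) (k + j) (x (k + j) ω)
        ≤ (1 - 2 * (β * δ * f') * N / k) * cubicLyapunov B (x k ω) + c / (k : ℝ) ^ 2 := by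
  have hβ := h.gain_pos
  obtain ⟨c, hc, hstep⟩ := h.exists_stepChange_cubicLyapunov_le hf' hB
  have hlim : Tendsto (fun k : ℕ => N * (β * M / ((k : ℝ) + 1))) atTop (𝓝 0) := by
    have := (tendsto_one_div_add_atTop_nhds_zero_nat (𝕜 := ℝ)).const_mul (N * (β * M))
    rw [mul_zero] at this
    exact this.congr fun k => by ring
  refine ⟨N * c, by positivity, ?_⟩
  filter_upwards [hlim.eventually_le_const (half_pos hr), eventually_gt_atTop 0]
    with k hsmall hk ω hω
  have hnorm : ∀ j < N, ‖x (k + j) ω‖ ≤ r := fun j hj => by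
    linarith [norm_le_norm_add_norm_sub' (x (k + j) ω) (x k ω), h.norm_window_sub_le k hj.le ω]
  have hsum := Finset.sum_le_sum fun j (hj : j ∈ Finset.range N) =>
    hstep k j ω hk (Finset.mem_range.1 hj) (by linarith)
      ((hnorm j (Finset.mem_range.1 hj)).trans hr₁)
      (hdrift (k + j) _ (hnorm j (Finset.mem_range.1 hj)))
  rw [Finset.sum_sub_distrib, Finset.sum_const, Finset.card_range, nsmul_eq_mul,
    ← Finset.sum_div, ← Finset.mul_sum, ← Finset.mul_sum, ← Finset.mul_sum] at hsum
  have hexc : β * (2 * f' * ((1 + B * ‖x k ω‖) * (N * δ * ‖x k ω‖ ^ 2))) / k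
      ≤ β * (2 * f' * ((1 + B * ‖x k ω‖)
        * ∑ j ∈ Finset.range N, (inner ℝ (φ (k + j + 1)) (x k ω) : ℝ) ^ 2)) / k := by
    gcongr
    exact h.excitation k _
  have hV : β * (2 * f' * ((1 + B * ‖x k ω‖) * (N * δ * ‖x k ω‖ ^ 2))) / k
      = 2 * (β * δ * f') * N / k * cubicLyapunov B (x k ω) := by
    unfold cubicLyapunov
    ring
  rw [sub_mul, one_mul, mul_div_assoc (N : ℝ)]
  linarith

theorem exists_cubicLyapunov_window_le_pow (h : StochasticRecursion P ℱ φ M β δ N g x₀ x ξ)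
    (hB : 0 ≤ B) : ∃ T, 0 ≤ T ∧ ∀ k : ℕ, 0 < k → ∀ ω,
      cubicLyapunov B (x (k + N) ω) ≤ T * (k : ℝ) ^ 3 := by
  have hβM := h.gain_mul_bound_nonneg
  set T := ‖x₀‖ + β * M * (2 + N) with hT
  have : 0 ≤ T := by positivity
  refine ⟨T ^ 2 + B * T ^ 3, by positivity, fun k hk ω => ?_⟩
  have hk₁ : (1 : ℝ) ≤ k := by exact_mod_cast hk
  have hnorm : ‖x (k + N) ω‖ ≤ T * k := by
    have hlog : 1 + Real.log ((k + N : ℕ) : ℝ) ≤ (2 + N) * k := by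
      have := Real.log_le_self (Nat.cast_nonneg (α := ℝ) (k + N))
      have := le_mul_of_one_le_right (Nat.cast_nonneg (α := ℝ) N) hk₁
      push_cast at *
      linarith
    have hinit := le_mul_of_one_le_right (norm_nonneg x₀) hk₁
    have := h.norm_le_log (k + N) ω
    grw [hlog] at this
    rw [hT]
    linarith
  calc cubicLyapunov B (x (k + N) ω) ≤ (T * k) ^ 2 + B * (T * k) ^ 3 := by
        unfold cubicLyapunov
        gcongr
    _ = T ^ 2 * (k : ℝ) ^ 2 + B * T ^ 3 * (k : ℝ) ^ 3 := by ring
    _ ≤ T ^ 2 * (k : ℝ) ^ 3 + B * T ^ 3 * (k : ℝ) ^ 3 := by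
        gcongr
        norm_num
    _ = (T ^ 2 + B * T ^ 3) * (k : ℝ) ^ 3 := by ring

variable [ProperSpace E] [IsProbabilityMeasure P]

theorem exists_setIntegral_cubicLyapunov_le (h : StochasticRecursion P ℱ φ M β δ N g x₀ x ξ)
    (hB : 0 ≤ B) {ρ : ℝ} (hρ : 0 < ρ) : ∃ T, 0 ≤ T ∧ ∀ᶠ k : ℕ in atTop,
      ∫ ω in {ω | ρ ≤ ‖x k ω‖}, cubicLyapunov B (x (k + N) ω) ∂P ≤ T / (k : ℝ) ^ 2 := by
  obtain ⟨T, hT, hle⟩ := h.exists_cubicLyapunov_window_le_pow hB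
  have hV := (radialMajorant_cubicLyapunov (E := E) hB le_rfl).continuous
  refine ⟨T, hT, ?_⟩
  filter_upwards [h.eventually_tail_mul_pow_le hρ 5, eventually_gt_atTop 0] with k htail hk
  calc ∫ ω in {ω | ρ ≤ ‖x k ω‖}, cubicLyapunov B (x (k + N) ω) ∂P
      ≤ ∫ _ω in {ω | ρ ≤ ‖x k ω‖}, T * (k : ℝ) ^ 3 ∂P :=
        setIntegral_mono (h.integrable_comp _ hV).integrableOn (integrable_const _).integrableOn
          (hle k hk)
    _ = T * (P.real {ω | ρ ≤ ‖x k ω‖} * (k : ℝ) ^ 5) / (k : ℝ) ^ 2 := by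
        rw [setIntegral_const, smul_eq_mul]
        field_simp
    _ ≤ T * 1 / (k : ℝ) ^ 2 := by gcongr
    _ = T / (k : ℝ) ^ 2 := by rw [mul_one]

theorem exists_isWindowContraction (h : StochasticRecursion P ℱ φ M β δ N g x₀ x ξ) {L ρ : ℝ}
    (hf' : 0 < f') (hL : 0 ≤ L) (hρ : 0 < ρ)
    (hloc : ∀ k u, |u| ≤ ρ → (f' - L * |u|) * u ^ 2 ≤ u * g (k + 1) u) :
    ∃ B c : ℝ, 0 ≤ B ∧ 0 ≤ c ∧
      IsWindowContraction (fun k => ∫ ω, cubicLyapunov B (x k ω) ∂P) N (2 * (β * δ * f')) c := by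
  obtain ⟨B, r, hB, hr, hr₁, hdrift⟩ := h.exists_weighted_drift_ge hf' hL hρ hloc
  obtain ⟨c, hc, hin⟩ := h.exists_cubicLyapunov_add_sum_stepChange_le hf'.le hB hr hr₁ hdrift
  obtain ⟨T, hT, hout⟩ := h.exists_setIntegral_cubicLyapunov_le hB (half_pos hr)
  have hβM := h.gain_mul_bound_nonneg
  refine ⟨B, c + T, hB, add_nonneg hc hT, ?_⟩
  filter_upwards [hin, hout, eventually_one_sub_div_nonneg (2 * (β * δ * f') * N)]
    with k hin hout hfac
  rw [add_div, ← add_assoc]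
  refine h.integral_add_window_le
    ((radialMajorant_cubicLyapunov hB hβM).mono (div_le_self hβM (by simp)))
    (cubicLyapunov_nonneg hB) (h.measurableSet_norm_ge (r / 2) k).compl (sub_nonneg.1 hfac)
    (by positivity) (fun ω hω => hin ω (not_le.1 hω)) ?_
  rwa [compl_compl]

theorem exists_isWindowContraction_sq_norm_le (h : StochasticRecursion P ℱ φ M β δ N g x₀ x ξ)
    {L ρ : ℝ} (hf' : 0 < f') (hL : 0 ≤ L) (hρ : 0 < ρ)
    (hloc : ∀ k u, |u| ≤ ρ → (f' - L * |u|) * u ^ 2 ≤ u * g (k + 1) u) :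
    ∃ (V : ℕ → ℝ) (c : ℝ), 0 ≤ c ∧ IsWindowContraction V N (2 * (β * δ * f')) c ∧
      (∀ k, 0 ≤ V k) ∧ (fun k => ∫ ω, ‖x k ω‖ ^ 2 ∂P) =O[atTop] V := by
  obtain ⟨B, c, hB, hc, hV⟩ := h.exists_isWindowContraction hf' hL hρ hloc
  have hnonneg : ∀ k, 0 ≤ ∫ ω, cubicLyapunov B (x k ω) ∂P := fun k =>
    integral_nonneg fun ω => cubicLyapunov_nonneg hB _
  refine ⟨_, c, hc, hV, hnonneg, Asymptotics.IsBigO.of_bound' (Eventually.of_forall fun k => ?_)⟩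
  rw [Real.norm_of_nonneg (integral_nonneg fun ω => sq_nonneg _), Real.norm_of_nonneg (hnonneg k)]
  exact integral_mono (h.integrable_comp k (G := fun v => ‖v‖ ^ 2) (by fun_prop))
    (h.integrable_comp k (radialMajorant_cubicLyapunov hB le_rfl).continuous)
    fun ω => sq_norm_le_cubicLyapunov hB _

theorem isBigO_inv_sq_norm (h : StochasticRecursion P ℱ φ M β δ N g x₀ x ξ) {L ρ : ℝ}
    (hf' : 0 < f') (hL : 0 ≤ L) (hρ : 0 < ρ)
    (hloc : ∀ k u, |u| ≤ ρ → (f' - L * |u|) * u ^ 2 ≤ u * g (k + 1) u)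
    (hp : 1 / 2 < β * δ * f') :
    (fun k => ∫ ω, ‖x k ω‖ ^ 2 ∂P) =O[atTop] fun k : ℕ => 1 / (k : ℝ) := by
  obtain ⟨V, c, hc, hV, hV₀, hle⟩ := h.exists_isWindowContraction_sq_norm_le hf' hL hρ hloc
  exact hle.trans (hV.isBigO_inv h.window_pos (by linarith) hc hV₀)

theorem isBigO_log_sq_norm (h : StochasticRecursion P ℱ φ M β δ N g x₀ x ξ) {L ρ : ℝ}
    (hf' : 0 < f') (hL : 0 ≤ L) (hρ : 0 < ρ)
    (hloc : ∀ k u, |u| ≤ ρ → (f' - L * |u|) * u ^ 2 ≤ u * g (k + 1) u)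
    (hp : β * δ * f' = 1 / 2) :
    (fun k => ∫ ω, ‖x k ω‖ ^ 2 ∂P) =O[atTop] fun k : ℕ => Real.log k / (k : ℝ) := by
  obtain ⟨V, c, hc, hV, hV₀, hle⟩ := h.exists_isWindowContraction_sq_norm_le hf' hL hρ hloc
  rw [hp, mul_one_div_cancel two_ne_zero] at hV
  exact hle.trans (hV.isBigO_log h.window_pos hc hV₀)

theorem isBigO_rpow_sq_norm (h : StochasticRecursion P ℱ φ M β δ N g x₀ x ξ) {L ρ : ℝ}
    (hf' : 0 < f') (hL : 0 ≤ L) (hρ : 0 < ρ)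
    (hloc : ∀ k u, |u| ≤ ρ → (f' - L * |u|) * u ^ 2 ≤ u * g (k + 1) u)
    (hp : β * δ * f' < 1 / 2) :
    (fun k => ∫ ω, ‖x k ω‖ ^ 2 ∂P) =O[atTop] fun k : ℕ => 1 / (k : ℝ) ^ (2 * (β * δ * f')) := by
  have := h.gain_pos
  have := h.level_pos
  obtain ⟨V, c, hc, hV, hV₀, hle⟩ := h.exists_isWindowContraction_sq_norm_le hf' hL hρ hloc
  exact hle.trans (hV.isBigO_rpow h.window_pos (by positivity) (by linarith) hc hV₀)

end CubicLyapunov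

end StochasticRecursion

theorem continuous_cdf (μ : Measure ℝ) [IsProbabilityMeasure μ] [NullSingletonClass μ] :
    Continuous (cdf μ) := by
  refine continuous_iff_continuousAt.2 fun a => ?_
  have hjump : cdf μ a - Function.leftLim (cdf μ) a ≤ 0 := by
    rw [← ENNReal.ofReal_eq_zero, ← StieltjesFunction.measure_singleton, measure_cdf,
      measure_singleton]
  rw [(monotone_cdf μ).continuousAt_iff_leftLim_eq_rightLim, StieltjesFunction.rightLim_eq]
  exact ((monotone_cdf μ).leftLim_le le_rfl).antisymm (sub_nonpos.1 hjump)

theorem mul_sub_le_cdf_sub {f : ℝ → ℝ} (hf : Measurable f) {μ : Measure ℝ} [IsProbabilityMeasure μ]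
    (hμ : μ = volume.withDensity fun t => ENNReal.ofReal (f t)) {a b c : ℝ} (hab : a ≤ b)
    (hc : ∀ t ∈ Icc a b, c ≤ f t) : c * (b - a) ≤ cdf μ b - cdf μ a := by
  rw [← ENNReal.ofReal_le_ofReal_iff (sub_nonneg.2 (monotone_cdf μ hab)),
    ← StieltjesFunction.measure_Ioc, measure_cdf, hμ, withDensity_apply _ measurableSet_Ioc]
  calc ENNReal.ofReal (c * (b - a)) = ENNReal.ofReal c * volume (Ioc a b) := by
        rw [Real.volume_Ioc, ENNReal.ofReal_mul' (sub_nonneg.2 hab)]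
    _ = ∫⁻ _ in Ioc a b, ENNReal.ofReal c := (setLIntegral_const _ _).symm
    _ ≤ ∫⁻ t in Ioc a b, ENNReal.ofReal (f t) := setLIntegral_mono hf.ennreal_ofReal
        fun t ht => ENNReal.ofReal_le_ofReal (hc t (Ioc_subset_Icc_self ht))

/-- The restoring force at displacement `u` of binary measurements with threshold `a`: the mean
change of the indicator of `d ≤ a - u`, for noise `d` with distribution function `F`. -/
def binaryForce (F : ℝ → ℝ) (a u : ℝ) : ℝ := F a - F (a - u)

/-- Noise `d 1, d 2, …` that is i.i.d. with distribution function `F` and density `f`, the infimum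
of `f` over any nonempty bounded open set being positive. The value `d 0` is irrelevant. -/
structure PositiveDensityNoise {Ω : Type*} {mΩ : MeasurableSpace Ω} (P : Measure Ω)
    (d : ℕ → Ω → ℝ) (F f : ℝ → ℝ) : Prop where
  measurable : ∀ k, Measurable (d (k + 1))
  indep : iIndepFun (fun k => d (k + 1)) P
  distribution : ∀ k t, F t = P.real {ω | d (k + 1) ω ≤ t}
  measurable_density : Measurable f
  density : ∀ k, P.map (d (k + 1)) = volume.withDensity fun t => ENNReal.ofReal (f t)
  density_inf_pos : ∀ X : Set ℝ, IsOpen X → Bornology.IsBounded X → X.Nonempty → 0 < sInf (f '' X)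

theorem AdmissibleNoise.toPositiveDensityNoise {Ω : Type*} [MeasurableSpace Ω]
    {P : Measure Ω} {d : ℕ → Ω → ℝ} {σ : ℝ} {F f : ℝ → ℝ} (hd : AdmissibleNoise P d σ F f) :
    PositiveDensityNoise P d F f where
  measurable k := hd.measurable (k + 1) (Nat.le_add_left 1 k)
  indep := hd.indep
  distribution k := hd.distribution (k + 1) (Nat.le_add_left 1 k)
  measurable_density := hd.measurable_density
  density k := hd.density (k + 1) (Nat.le_add_left 1 k)
  density_inf_pos := hd.density_inf_pos

namespace PositiveDensityNoise

variable {Ω : Type*} {mΩ : MeasurableSpace Ω} {P : Measure Ω} {d : ℕ → Ω → ℝ} {F f : ℝ → ℝ}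

theorem exists_forall_le_density (hd : PositiveDensityNoise P d F f) (C r : ℝ) :
    ∃ c, 0 < c ∧ ∀ t, |t - C| ≤ r → c ≤ f t := by
  have hpos := hd.density_inf_pos (Metric.ball C (|r| + 1)) Metric.isOpen_ball
    Metric.isBounded_ball (Metric.nonempty_ball.2 (by positivity))
  -- The infimum of a set that is not bounded below is `0` by convention.
  have hbdd : BddBelow (f '' Metric.ball C (|r| + 1)) := by
    by_contra hunbdd
    exact hpos.ne' (Real.sInf_of_not_bddBelow hunbdd)
  exact ⟨_, hpos, fun t ht => csInf_le hbdd
    ⟨t, Metric.mem_ball.2 (by rw [Real.dist_eq]; linarith [le_abs_self r]), rfl⟩⟩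

theorem density_pos (hd : PositiveDensityNoise P d F f) (t : ℝ) : 0 < f t := by
  obtain ⟨c, hc, hcf⟩ := hd.exists_forall_le_density t 0
  exact hc.trans_le (hcf t (by simp))

section LowerDensity

theorem sInf_image_Icc_le (hd : PositiveDensityNoise P d F f) {C z t : ℝ} (ht : |t - C| ≤ z) :
    sInf (f '' Icc (C - z) (C + z)) ≤ f t := by
  refine csInf_le ⟨0, forall_mem_image.2 fun s _ => (hd.density_pos s).le⟩ ⟨t, ?_, rfl⟩
  rw [abs_le] at ht
  constructor <;> linarith

theorem tendsto_sInf_image_Icc (hd : PositiveDensityNoise P d F f) (C : ℝ) {R : ℝ} (hR : 0 ≤ R) :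
    Tendsto (fun z => sInf (f '' Icc (C - z) (C + z))) (𝓝[>] R) (𝓝 (lowerDensity f C R)) :=
  tendsto_lowerDensity f (fun t => (hd.density_pos t).le) C R hR

theorem lowerDensity_pos (hd : PositiveDensityNoise P d F f) (C : ℝ) {R : ℝ} (hR : 0 ≤ R) :
    0 < lowerDensity f C R := by
  obtain ⟨c, hc, hcf⟩ := hd.exists_forall_le_density C (R + 1)
  refine hc.trans_le (ge_of_tendsto (hd.tendsto_sInf_image_Icc C hR) ?_)
  filter_upwards [Ioo_mem_nhdsGT (lt_add_one R)] with z ⟨hRz, hzR⟩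
  refine le_csInf ((nonempty_Icc.2 (by linarith)).image f) (forall_mem_image.2 fun t ht => hcf t ?_)
  exact abs_le.2 ⟨by linarith [ht.1], by linarith [ht.2]⟩

theorem lowerDensity_le (hd : PositiveDensityNoise P d F f) {C R t : ℝ} (ht : |t - C| ≤ R) :
    lowerDensity f C R ≤ f t := by
  refine le_of_tendsto (hd.tendsto_sInf_image_Icc C ((abs_nonneg _).trans ht)) ?_
  filter_upwards [self_mem_nhdsWithin] with z hz
  exact hd.sInf_image_Icc_le (ht.trans (le_of_lt hz))

end LowerDensity

section Distribution

theorem isProbabilityMeasure_map [IsProbabilityMeasure P] (hd : PositiveDensityNoise P d F f)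
    (k : ℕ) : IsProbabilityMeasure (P.map (d (k + 1))) :=
  Measure.isProbabilityMeasure_map (hd.measurable k).aemeasurable

variable [IsProbabilityMeasure P]

theorem eq_cdf (hd : PositiveDensityNoise P d F f) : F = cdf (P.map (d 1)) := by
  have := hd.isProbabilityMeasure_map 0
  ext t
  rw [hd.distribution 0, cdf_eq_real, map_measureReal_apply (hd.measurable 0) measurableSet_Iic]
  rfl

theorem monotone (hd : PositiveDensityNoise P d F f) : Monotone F := by
  rw [hd.eq_cdf]
  exact monotone_cdf _

theorem distribution_mem_Icc (hd : PositiveDensityNoise P d F f) (t : ℝ) : F t ∈ Icc 0 1 := by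
  rw [hd.eq_cdf]
  exact ⟨cdf_nonneg _ t, cdf_le_one _ t⟩

theorem continuous (hd : PositiveDensityNoise P d F f) : Continuous F := by
  have := hd.isProbabilityMeasure_map 0
  have : NullSingletonClass (P.map (d 1)) := by
    rw [hd.density 0]
    infer_instance
  rw [hd.eq_cdf]
  exact continuous_cdf _

theorem mul_sub_le (hd : PositiveDensityNoise P d F f) {a b c : ℝ} (hab : a ≤ b)
    (hc : ∀ t ∈ Icc a b, c ≤ f t) : c * (b - a) ≤ F b - F a := by
  have := hd.isProbabilityMeasure_map 0
  rw [hd.eq_cdf]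
  exact mul_sub_le_cdf_sub hd.measurable_density (hd.density 0) hab hc

theorem mul_sq_le_mul_binaryForce (hd : PositiveDensityNoise P d F f) {a u c : ℝ}
    (hc : ∀ t, |t - a| ≤ |u| → c ≤ f t) : c * u ^ 2 ≤ u * binaryForce F a u := by
  unfold binaryForce
  rcases le_total 0 u with hu | hu
  · have hinc := hd.mul_sub_le (a := a - u) (b := a) (by linarith) fun t ht => hc t (by
      rw [abs_of_nonneg hu, abs_le]; constructor <;> linarith [ht.1, ht.2])
    nlinarith [mul_le_mul_of_nonneg_left hinc hu]
  · have hinc := hd.mul_sub_le (a := a) (b := a - u) (by linarith) fun t ht => hc t (by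
      rw [abs_of_nonpos hu, abs_le]; constructor <;> linarith [ht.1, ht.2])
    nlinarith [mul_le_mul_of_nonneg_left hinc (neg_nonneg.2 hu)]

theorem mul_binaryForce_nonneg (hd : PositiveDensityNoise P d F f) (a u : ℝ) :
    0 ≤ u * binaryForce F a u := by
  simpa using hd.mul_sq_le_mul_binaryForce (a := a) (u := u) fun t _ => (hd.density_pos t).le

theorem exists_mul_abs_le_mul_binaryForce (hd : PositiveDensityNoise P d F f) (C R : ℝ) {r : ℝ}
    (hr : 0 < r) :
    ∃ c, 0 < c ∧ ∀ a u, |a - C| ≤ R → r ≤ |u| → c * |u| ≤ u * binaryForce F a u := by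
  obtain ⟨c, hc, hcf⟩ := hd.exists_forall_le_density C (R + r)
  have hnear : ∀ {a}, |a - C| ≤ R → ∀ t, |t - a| ≤ r → c ≤ f t := fun ha t ht =>
    hcf t ((abs_sub_le t _ C).trans (by linarith))
  refine ⟨c * r, by positivity, fun a u ha hu => ?_⟩
  unfold binaryForce
  rcases le_total 0 u with hu₀ | hu₀
  · rw [abs_of_nonneg hu₀] at hu ⊢
    have hinc := hd.mul_sub_le (a := a - r) (b := a) (by linarith) fun t ht => hnear ha t
      (abs_le.2 ⟨by linarith [ht.1], by linarith [ht.2]⟩)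
    have hmono : F (a - u) ≤ F (a - r) := hd.monotone (by linarith)
    nlinarith
  · rw [abs_of_nonpos hu₀] at hu ⊢
    have hinc := hd.mul_sub_le (a := a) (b := a + r) (by linarith) fun t ht => hnear ha t
      (abs_le.2 ⟨by linarith [ht.1], by linarith [ht.2]⟩)
    have hmono : F (a + r) ≤ F (a - u) := hd.monotone (by linarith)
    nlinarith

theorem exists_radius_mul_sq_le (hd : PositiveDensityNoise P d F f) {C R f' : ℝ} (hR : 0 ≤ R)
    (hf' : f' < lowerDensity f C R) :
    ∃ ρ, 0 < ρ ∧ ∀ a u, |a - C| ≤ R → |u| ≤ ρ → f' * u ^ 2 ≤ u * binaryForce F a u := by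
  obtain ⟨z, hz, hRz : R < z⟩ := (((hd.tendsto_sInf_image_Icc C hR).eventually_const_lt hf').and
    self_mem_nhdsWithin).exists
  refine ⟨z - R, sub_pos.2 hRz, fun a u ha hu => hd.mul_sq_le_mul_binaryForce fun t ht => ?_⟩
  exact hz.le.trans (hd.sInf_image_Icc_le ((abs_sub_le t a C).trans (by linarith)))

theorem exists_lipschitz_mul_sq_le (hd : PositiveDensityNoise P d F f) (hf : LocallyLipschitz f)
    (C R : ℝ) :
    ∃ L, 0 ≤ L ∧ ∀ a u, |a - C| ≤ R → |u| ≤ 1 →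
      (lowerDensity f C R - L * |u|) * u ^ 2 ≤ u * binaryForce F a u := by
  obtain ⟨K, hK⟩ := hf.locallyLipschitzOn.exists_lipschitzOnWith_of_compact
    (isCompact_closedBall C (R + 1))
  refine ⟨K, K.2, fun a u ha hu => hd.mul_sq_le_mul_binaryForce fun t ht => ?_⟩
  have haK : a ∈ Metric.closedBall C (R + 1) := Metric.mem_closedBall.2 (by
    rw [Real.dist_eq]; linarith)
  have htK : t ∈ Metric.closedBall C (R + 1) := Metric.mem_closedBall.2 (by
    rw [Real.dist_eq]; linarith [abs_sub_le t a C])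
  have hlip : |f a - f t| ≤ K * |t - a| := by
    simpa only [Real.dist_eq, abs_sub_comm a t] using hK.dist_le_mul a haK t htK
  calc lowerDensity f C R - K * |u| ≤ f a - K * |t - a| := by
        gcongr
        exact hd.lowerDensity_le ha
    _ ≤ f t := by linarith [le_abs_self (f a - f t)]

end Distribution

section Filtration

/-- The σ-algebras generated by the first `k` noise variables `d 1, …, d k`. -/
def noiseFiltration (hd : PositiveDensityNoise P d F f) : Filtration ℕ mΩ where
  seq k := ⨆ i ∈ {i | i < k}, MeasurableSpace.comap (d (i + 1)) inferInstance
  mono' _ _ hkl := biSup_mono fun _ hi => lt_of_lt_of_le hi hkl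
  le' _ := iSup₂_le fun i _ => (hd.measurable i).comap_le

theorem comap_le_noiseFiltration (hd : PositiveDensityNoise P d F f) (k : ℕ) :
    MeasurableSpace.comap (d (k + 1)) inferInstance ≤ hd.noiseFiltration (k + 1) :=
  le_iSup₂_of_le (f := fun i (_ : i ∈ {i | i < k + 1}) =>
    MeasurableSpace.comap (d (i + 1)) inferInstance) k (Nat.lt_succ_self k) le_rfl

theorem indep_noiseFiltration (hd : PositiveDensityNoise P d F f) (k : ℕ) :
    Indep (MeasurableSpace.comap (d (k + 1)) inferInstance) (hd.noiseFiltration k) P := by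
  have hindep := indep_iSup_of_disjoint (fun i => (hd.measurable i).comap_le) hd.indep.iIndep
    (S := {k}) (T := {i | i < k}) (by simp)
  rwa [iSup_singleton] at hindep

theorem integral_comp_indicator_Iic (hd : PositiveDensityNoise P d F f) (k : ℕ) (a : ℝ) :
    ∫ ω, (Iic a).indicator 1 (d (k + 1) ω) ∂P = F a := by
  rw [hd.distribution k]
  exact integral_indicator_one (hd.measurable k measurableSet_Iic)

theorem condExp_comp_noise [IsProbabilityMeasure P] (hd : PositiveDensityNoise P d F f) (k : ℕ)
    {ψ : ℝ → ℝ} (hψ : Measurable ψ) :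
    P[fun ω => ψ (d (k + 1) ω) | hd.noiseFiltration k] =ᵐ[P] fun _ => ∫ ω, ψ (d (k + 1) ω) ∂P :=
  condExp_indep_eq (hd.measurable k).comap_le (hd.noiseFiltration.le k)
    (hψ.comp (comap_measurable _)).stronglyMeasurable (hd.indep_noiseFiltration k)

end Filtration

end PositiveDensityNoise

section BinaryIdentification

variable {n : ℕ} {Ω : Type*} {φ : ℕ → EuclideanSpace ℝ (Fin n)} {M : ℝ} {N : ℕ} {δ : ℝ}
  {d : ℕ → Ω → ℝ} {F : ℝ → ℝ}

theorem dotProduct_vecMulVec_mulVec_self (v w : EuclideanSpace ℝ (Fin n)) :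
    v.ofLp ⬝ᵥ (Matrix.vecMulVec w.ofLp w.ofLp).mulVec v.ofLp = (inner ℝ w v : ℝ) ^ 2 := by
  rw [Matrix.vecMulVec_mulVec, EuclideanSpace.inner_eq_star_dotProduct, star_trivial,
    op_smul_eq_smul, dotProduct_smul, smul_eq_mul, dotProduct_comm w.ofLp, sq]

theorem PersistentlyExciting.sum_sq_inner_ge (hφ : PersistentlyExciting φ M N δ) (k : ℕ)
    (v : EuclideanSpace ℝ (Fin n)) :
    N * δ * ‖v‖ ^ 2 ≤ ∑ i ∈ Finset.range N, (inner ℝ (φ (k + i + 1)) v : ℝ) ^ 2 := by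
  have hN : (0 : ℝ) < N := by exact_mod_cast hφ.pos_window
  have hnorm : v.ofLp ⬝ᵥ v.ofLp = ‖v‖ ^ 2 := by
    rw [EuclideanSpace.real_norm_sq_eq, dotProduct]
    exact Finset.sum_congr rfl fun i _ => (sq _).symm
  have hpsd := (hφ.excitation (k + 1) (Nat.le_add_left 1 k)).dotProduct_mulVec_nonneg v.ofLp
  simp only [star_trivial, Matrix.sub_mulVec, dotProduct_sub, Matrix.smul_mulVec, dotProduct_smul,
    Matrix.one_mulVec, Matrix.sum_mulVec, dotProduct_sum, hnorm,
    dotProduct_vecMulVec_mulVec_self, smul_eq_mul, Finset.sum_Ico_eq_sum_range,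
    add_tsub_cancel_left] at hpsd
  simp only [add_right_comm k 1] at hpsd
  rw [mul_assoc, ← le_div_iff₀' hN, div_eq_inv_mul, inv_eq_one_div]
  exact sub_nonneg.1 hpsd

theorem binaryObs_eq_indicator (φ : ℕ → EuclideanSpace ℝ (Fin n)) (θ : EuclideanSpace ℝ (Fin n))
    (d : ℕ → Ω → ℝ) (C : ℝ) (k : ℕ) (ω : Ω) :
    binaryObs φ θ d C k ω = (Iic (C - inner ℝ (φ k) θ)).indicator 1 (d k ω) := by
  by_cases h : inner ℝ (φ k) θ + d k ω ≤ C <;>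
    simp [binaryObs, output, indicator, le_sub_iff_add_le', h]

theorem binaryObs_mem_Icc (φ : ℕ → EuclideanSpace ℝ (Fin n)) (θ : EuclideanSpace ℝ (Fin n))
    (d : ℕ → Ω → ℝ) (C : ℝ) (k : ℕ) (ω : Ω) : binaryObs φ θ d C k ω ∈ Icc 0 1 := by
  unfold binaryObs
  split_ifs <;> simp

/-- The centred observation noise: the mean of the binary observation `s_k` minus `s_k`. -/
noncomputable def binaryNoise (φ : ℕ → EuclideanSpace ℝ (Fin n)) (θ : EuclideanSpace ℝ (Fin n))
    (d : ℕ → Ω → ℝ) (F : ℝ → ℝ) (C : ℝ) (k : ℕ) (ω : Ω) : ℝ :=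
  F (C - inner ℝ (φ k) θ) - binaryObs φ θ d C k ω

theorem binaryNoise_sub_binaryForce (θ : EuclideanSpace ℝ (Fin n)) (C : ℝ) (k : ℕ) (u : ℝ)
    (ω : Ω) :
    binaryNoise φ θ d F C k ω - binaryForce F (C - inner ℝ (φ k) θ) u
      = F (C - inner ℝ (φ k) θ - u) - binaryObs φ θ d C k ω := by
  unfold binaryNoise binaryForce
  ring

theorem estError_succ (θ : EuclideanSpace ℝ (Fin n)) (C β : ℝ) (θ₀ : EuclideanSpace ℝ (Fin n))
    (k : ℕ) (ω : Ω) :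
    estError φ θ d F C β θ₀ (k + 1) ω = estError φ θ d F C β θ₀ k ω +
      (β / ((k : ℝ) + 1) * (binaryNoise φ θ d F C (k + 1) ω
        - binaryForce F (C - inner ℝ (φ (k + 1)) θ)
          (inner ℝ (φ (k + 1)) (estError φ θ d F C β θ₀ k ω)))) • φ (k + 1) := by
  rw [binaryNoise_sub_binaryForce]
  simp only [estError, saEstimate, inner_sub_right, sub_sub, add_sub_cancel, Nat.cast_add_one]
  abel

theorem PersistentlyExciting.abs_threshold_sub_le (hφ : PersistentlyExciting φ M N δ)
    (θ : EuclideanSpace ℝ (Fin n)) (C : ℝ) (k : ℕ) :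
    |C - inner ℝ (φ (k + 1)) θ - C| ≤ M * ‖θ‖ := by
  rw [sub_sub_cancel_left, abs_neg]
  exact abs_inner_le_mul_norm (hφ.norm_le (k + 1) (Nat.le_add_left 1 k)) θ

theorem PersistentlyExciting.bound_mul_norm_nonneg (hφ : PersistentlyExciting φ M N δ)
    (θ : EuclideanSpace ℝ (Fin n)) : 0 ≤ M * ‖θ‖ :=
  mul_nonneg ((norm_nonneg _).trans (hφ.norm_le 1 le_rfl)) (norm_nonneg θ)

variable {mΩ : MeasurableSpace Ω} {P : Measure Ω} {f : ℝ → ℝ}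

theorem PositiveDensityNoise.measurable_binaryNoise (hd : PositiveDensityNoise P d F f)
    (θ : EuclideanSpace ℝ (Fin n)) (C : ℝ) (k : ℕ) :
    Measurable[hd.noiseFiltration (k + 1)] (binaryNoise φ θ d F C (k + 1)) := by
  have hd' : Measurable[hd.noiseFiltration (k + 1)] (d (k + 1)) :=
    (comap_measurable _).mono (hd.comap_le_noiseFiltration k) le_rfl
  unfold binaryNoise
  simp_rw [binaryObs_eq_indicator]
  exact measurable_const.sub ((measurable_one.indicator measurableSet_Iic).comp hd')

variable [IsProbabilityMeasure P]

theorem PositiveDensityNoise.abs_sub_binaryObs_le (hd : PositiveDensityNoise P d F f)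
    (θ : EuclideanSpace ℝ (Fin n)) (C t : ℝ) (k : ℕ) (ω : Ω) :
    |F t - binaryObs φ θ d C k ω| ≤ 1 := by
  have hF := hd.distribution_mem_Icc t
  have hs := binaryObs_mem_Icc φ θ d C k ω
  exact abs_le.2 ⟨by linarith [hF.1, hs.2], by linarith [hF.2, hs.1]⟩

theorem PositiveDensityNoise.integrable_binaryNoise (hd : PositiveDensityNoise P d F f)
    (θ : EuclideanSpace ℝ (Fin n)) (C : ℝ) (k : ℕ) :
    Integrable (binaryNoise φ θ d F C (k + 1)) P :=
  Integrable.of_bound ((hd.measurable_binaryNoise θ C k).mono (hd.noiseFiltration.le _)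
    le_rfl).aestronglyMeasurable 1 (ae_of_all P (hd.abs_sub_binaryObs_le θ C _ (k + 1)))

theorem PositiveDensityNoise.condExp_binaryNoise (hd : PositiveDensityNoise P d F f)
    (θ : EuclideanSpace ℝ (Fin n)) (C : ℝ) (k : ℕ) :
    P[binaryNoise φ θ d F C (k + 1) | hd.noiseFiltration k] =ᵐ[P] 0 := by
  set a := C - inner ℝ (φ (k + 1)) θ
  have hψ : Measurable fun t => F a - (Iic a).indicator 1 t :=
    measurable_const.sub (measurable_one.indicator measurableSet_Iic)
  have hnoise : binaryNoise φ θ d F C (k + 1)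
      = fun ω => F a - (Iic a).indicator 1 (d (k + 1) ω) := by
    funext ω
    rw [binaryNoise, binaryObs_eq_indicator]
  have hmean : ∫ ω, (F a - (Iic a).indicator 1 (d (k + 1) ω)) ∂P = 0 := by
    have hint : Integrable (fun ω => (Iic a).indicator (1 : ℝ → ℝ) (d (k + 1) ω)) P :=
      (integrable_const (1 : ℝ)).indicator (hd.measurable k measurableSet_Iic)
    rw [integral_sub (integrable_const _) hint, hd.integral_comp_indicator_Iic]
    simp
  rw [hnoise]
  filter_upwards [hd.condExp_comp_noise k hψ] with ω hω
  rw [hω, hmean, Pi.zero_apply]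

theorem stochasticRecursion_estError (hφ : PersistentlyExciting φ M N δ)
    (hd : PositiveDensityNoise P d F f) (θ : EuclideanSpace ℝ (Fin n)) (C : ℝ) {β : ℝ}
    (hβ : 0 < β) (θ₀ : EuclideanSpace ℝ (Fin n)) :
    StochasticRecursion P hd.noiseFiltration φ M β δ N
      (fun k => binaryForce F (C - inner ℝ (φ k) θ)) (θ₀ - θ) (estError φ θ d F C β θ₀)
      (binaryNoise φ θ d F C) where
  gain_pos := hβ
  level_pos := hφ.pos_level
  window_pos := hφ.pos_window
  norm_regressor_le k := hφ.norm_le (k + 1) (Nat.le_add_left 1 k)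
  excitation := hφ.sum_sq_inner_ge
  init _ := rfl
  recursion := estError_succ θ C β θ₀
  abs_innovation_le k ω := by
    rw [binaryNoise_sub_binaryForce]
    exact hd.abs_sub_binaryObs_le θ C _ (k + 1) ω
  noise_adapted k := (hd.measurable_binaryNoise θ C k).stronglyMeasurable
  noise_integrable := hd.integrable_binaryNoise θ C
  condExp_noise := hd.condExp_binaryNoise θ C
  force_continuous k := by
    have := hd.continuous
    unfold binaryForce
    fun_prop
  force_nonneg k := hd.mul_binaryForce_nonneg _
  force_lower r hr := by
    obtain ⟨c, hc, hle⟩ := hd.exists_mul_abs_le_mul_binaryForce C (M * ‖θ‖) hr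
    exact ⟨c, hc, fun k u => hle _ u (hφ.abs_threshold_sub_le θ C k)⟩

section Rates

variable {θ : EuclideanSpace ℝ (Fin n)} {C β η : ℝ}

theorem exists_force_ge_of_lt (hφ : PersistentlyExciting φ M N δ)
    (hd : PositiveDensityNoise P d F f) (hβ : 0 < β) (hη₀ : 0 < η)
    (hη : η < β * δ * lowerDensity f C (M * ‖θ‖)) :
    ∃ f' ρ, 0 < f' ∧ 0 < ρ ∧ β * δ * f' = η ∧ ∀ k u, |u| ≤ ρ →
      (f' - 0 * |u|) * u ^ 2 ≤ u * binaryForce F (C - inner ℝ (φ (k + 1)) θ) u := by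
  have hβδ : 0 < β * δ := mul_pos hβ hφ.pos_level
  obtain ⟨ρ, hρ, hloc⟩ := hd.exists_radius_mul_sq_le
    (hφ.bound_mul_norm_nonneg θ) ((div_lt_iff₀' hβδ).2 hη)
  exact ⟨_, ρ, div_pos hη₀ hβδ, hρ, mul_div_cancel₀ η hβδ.ne', fun k u hu => by
    simpa using hloc _ u (hφ.abs_threshold_sub_le θ C k) hu⟩

theorem isBigO_inv_sq_norm_estError (hφ : PersistentlyExciting φ M N δ)
    (hd : PositiveDensityNoise P d F f) (hβ : 0 < β) (θ₀ : EuclideanSpace ℝ (Fin n))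
    (hη : 1 / 2 < β * δ * lowerDensity f C (M * ‖θ‖)) :
    (fun k => ∫ ω, ‖estError φ θ d F C β θ₀ k ω‖ ^ 2 ∂P) =O[atTop] fun k : ℕ => 1 / (k : ℝ) := by
  obtain ⟨η', hη', hlt⟩ := exists_between hη
  obtain ⟨f', ρ, hf', hρ, rfl, hloc⟩ :=
    exists_force_ge_of_lt hφ hd hβ (one_half_pos.trans hη') hlt
  exact (stochasticRecursion_estError hφ hd θ C hβ θ₀).isBigO_inv_sq_norm hf' le_rfl hρ hloc hη'

theorem isBigO_rpow_sq_norm_estError_of_lt (hφ : PersistentlyExciting φ M N δ)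
    (hd : PositiveDensityNoise P d F f) (hβ : 0 < β) (θ₀ : EuclideanSpace ℝ (Fin n))
    (hη : η < β * δ * lowerDensity f C (M * ‖θ‖)) (hη' : η < 1 / 2) :
    (fun k => ∫ ω, ‖estError φ θ d F C β θ₀ k ω‖ ^ 2 ∂P)
      =O[atTop] fun k : ℕ => 1 / (k : ℝ) ^ (2 * η) := by
  have hpos : 0 < β * δ * lowerDensity f C (M * ‖θ‖) :=
    mul_pos (mul_pos hβ hφ.pos_level) (hd.lowerDensity_pos C (hφ.bound_mul_norm_nonneg θ))
  -- A rate `η ≤ 0` is inherited from any positive rate that is still admissible.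
  obtain ⟨η₁, hη₁, hlt⟩ := exists_between
    (lt_min (max_lt hη hpos) (max_lt hη' one_half_pos))
  obtain ⟨f', ρ, hf', hρ, rfl, hloc⟩ :=
    exists_force_ge_of_lt hφ hd hβ ((le_max_right _ _).trans_lt hη₁)
      (hlt.trans_le (min_le_left _ _))
  refine ((stochasticRecursion_estError hφ hd θ C hβ θ₀).isBigO_rpow_sq_norm hf' le_rfl hρ hloc
    (hlt.trans_le (min_le_right _ _))).trans (Asymptotics.IsBigO.of_bound' ?_)
  filter_upwards [eventually_ge_atTop 1] with k hk
  have hk₁ : (1 : ℝ) ≤ k := by exact_mod_cast hk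
  rw [Real.norm_of_nonneg (by positivity), Real.norm_of_nonneg (by positivity)]
  gcongr
  exact (le_max_left _ _).trans hη₁.le

theorem exists_force_ge_of_locallyLipschitz (hφ : PersistentlyExciting φ M N δ)
    (hd : PositiveDensityNoise P d F f) (hf : LocallyLipschitz f)
    (θ : EuclideanSpace ℝ (Fin n)) (C : ℝ) :
    ∃ L, 0 ≤ L ∧ ∀ k u, |u| ≤ 1 → (lowerDensity f C (M * ‖θ‖) - L * |u|) * u ^ 2
      ≤ u * binaryForce F (C - inner ℝ (φ (k + 1)) θ) u := by
  obtain ⟨L, hL, hloc⟩ := hd.exists_lipschitz_mul_sq_le hf C (M * ‖θ‖)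
  exact ⟨L, hL, fun k u hu => hloc _ u (hφ.abs_threshold_sub_le θ C k) hu⟩

theorem isBigO_log_sq_norm_estError (hφ : PersistentlyExciting φ M N δ)
    (hd : PositiveDensityNoise P d F f) (hf : LocallyLipschitz f) (hβ : 0 < β)
    (θ₀ : EuclideanSpace ℝ (Fin n)) (hη : β * δ * lowerDensity f C (M * ‖θ‖) = 1 / 2) :
    (fun k => ∫ ω, ‖estError φ θ d F C β θ₀ k ω‖ ^ 2 ∂P)
      =O[atTop] fun k : ℕ => Real.log k / (k : ℝ) := by
  obtain ⟨L, hL, hloc⟩ := exists_force_ge_of_locallyLipschitz hφ hd hf θ C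
  exact (stochasticRecursion_estError hφ hd θ C hβ θ₀).isBigO_log_sq_norm
    (hd.lowerDensity_pos C (hφ.bound_mul_norm_nonneg θ)) hL one_pos hloc hη

theorem isBigO_rpow_sq_norm_estError (hφ : PersistentlyExciting φ M N δ)
    (hd : PositiveDensityNoise P d F f) (hf : LocallyLipschitz f) (hβ : 0 < β)
    (θ₀ : EuclideanSpace ℝ (Fin n)) (hη : β * δ * lowerDensity f C (M * ‖θ‖) < 1 / 2) :
    (fun k => ∫ ω, ‖estError φ θ d F C β θ₀ k ω‖ ^ 2 ∂P)
      =O[atTop] fun k : ℕ => 1 / (k : ℝ) ^ (2 * (β * δ * lowerDensity f C (M * ‖θ‖))) := by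
  obtain ⟨L, hL, hloc⟩ := exists_force_ge_of_locallyLipschitz hφ hd hf θ C
  exact (stochasticRecursion_estError hφ hd θ C hβ θ₀).isBigO_rpow_sq_norm
    (hd.lowerDensity_pos C (hφ.bound_mul_norm_nonneg θ)) hL one_pos hloc hη

end Rates

end BinaryIdentification

theorem theorem6_general {n : ℕ} {Ω : Type*} [MeasurableSpace Ω] (P : Measure Ω)
    [IsProbabilityMeasure P]
    (φ : ℕ → EuclideanSpace ℝ (Fin n)) (M : ℝ) (N : ℕ) (δ : ℝ)
    (hφ : PersistentlyExciting φ M N δ)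
    (d : ℕ → Ω → ℝ) (F f : ℝ → ℝ)
    (hd : PositiveDensityNoise P d F f)
    (θ : EuclideanSpace ℝ (Fin n)) (C : ℝ)
    (β : ℝ) (hβ : 0 < β) (θ₀ : EuclideanSpace ℝ (Fin n))
    (η : ℝ) (hη : η = β * δ * lowerDensity f C (M * ‖θ‖)) :
    (∀ k : ℕ, Integrable (fun ω => ‖estError φ θ d F C β θ₀ k ω‖ ^ 2) P) ∧
    (∀ ε : ℝ, 0 < ε →
      (1 / 2 < η →
        (fun k : ℕ => ∫ ω, ‖estError φ θ d F C β θ₀ k ω‖ ^ 2 ∂P)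
          =O[atTop] (fun k : ℕ => 1 / (k : ℝ))) ∧
      (η ≤ 1 / 2 →
        (fun k : ℕ => ∫ ω, ‖estError φ θ d F C β θ₀ k ω‖ ^ 2 ∂P)
          =O[atTop] (fun k : ℕ => 1 / (k : ℝ) ^ (2 * η - ε)))) ∧
    (LocallyLipschitz f →
      (1 / 2 < η →
        (fun k : ℕ => ∫ ω, ‖estError φ θ d F C β θ₀ k ω‖ ^ 2 ∂P)
          =O[atTop] (fun k : ℕ => 1 / (k : ℝ))) ∧
      (η = 1 / 2 →
        (fun k : ℕ => ∫ ω, ‖estError φ θ d F C β θ₀ k ω‖ ^ 2 ∂P)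
          =O[atTop] (fun k : ℕ => Real.log (k : ℝ) / (k : ℝ))) ∧
      (η < 1 / 2 →
        (fun k : ℕ => ∫ ω, ‖estError φ θ d F C β θ₀ k ω‖ ^ 2 ∂P)
          =O[atTop] (fun k : ℕ => 1 / (k : ℝ) ^ (2 * η)))) := by
  subst hη
  have hfast := isBigO_inv_sq_norm_estError (C := C) (θ := θ) hφ hd hβ θ₀
  refine ⟨fun k => (stochasticRecursion_estError hφ hd θ C hβ θ₀).integrable_comp k
    (G := fun v => ‖v‖ ^ 2) (by fun_prop), fun ε hε => ⟨hfast, fun hη => ?_⟩, fun hf =>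
    ⟨hfast, isBigO_log_sq_norm_estError hφ hd hf hβ θ₀,
      isBigO_rpow_sq_norm_estError hφ hd hf hβ θ₀⟩⟩
  have hslack := sub_lt_self (β * δ * lowerDensity f C (M * ‖θ‖)) (half_pos hε)
  simpa only [mul_sub, mul_div_cancel₀ ε (two_ne_zero (α := ℝ))] using
    isBigO_rpow_sq_norm_estError_of_lt hφ hd hβ θ₀ hslack (hslack.trans_le hη)

theorem theorem6 {n : ℕ} {Ω : Type*} [MeasurableSpace Ω] (P : Measure Ω) [IsProbabilityMeasure P]
    (φ : ℕ → EuclideanSpace ℝ (Fin n)) (M : ℝ) (N : ℕ) (δ : ℝ)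
    (hφ : PersistentlyExciting φ M N δ)
    (d : ℕ → Ω → ℝ) (σ : ℝ) (F f : ℝ → ℝ)
    (hd : AdmissibleNoise P d σ F f)
    (θ : EuclideanSpace ℝ (Fin n)) (C : ℝ)
    (β : ℝ) (hβ : 0 < β) (θ₀ : EuclideanSpace ℝ (Fin n))
    (η : ℝ) (hη : η = β * δ * lowerDensity f C (M * ‖θ‖)) :
    (∀ k : ℕ, Integrable (fun ω => ‖estError φ θ d F C β θ₀ k ω‖ ^ 2) P) ∧
    (∀ ε : ℝ, 0 < ε →
      (1 / 2 < η →
        (fun k : ℕ => ∫ ω, ‖estError φ θ d F C β θ₀ k ω‖ ^ 2 ∂P)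
          =O[atTop] (fun k : ℕ => 1 / (k : ℝ))) ∧
      (η ≤ 1 / 2 →
        (fun k : ℕ => ∫ ω, ‖estError φ θ d F C β θ₀ k ω‖ ^ 2 ∂P)
          =O[atTop] (fun k : ℕ => 1 / (k : ℝ) ^ (2 * η - ε)))) ∧
    (LocallyLipschitz f →
      (1 / 2 < η →
        (fun k : ℕ => ∫ ω, ‖estError φ θ d F C β θ₀ k ω‖ ^ 2 ∂P)
          =O[atTop] (fun k : ℕ => 1 / (k : ℝ))) ∧
      (η = 1 / 2 →
        (fun k : ℕ => ∫ ω, ‖estError φ θ d F C β θ₀ k ω‖ ^ 2 ∂P)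
          =O[atTop] (fun k : ℕ => Real.log (k : ℝ) / (k : ℝ))) ∧
      (η < 1 / 2 →
        (fun k : ℕ => ∫ ω, ‖estError φ θ d F C β θ₀ k ω‖ ^ 2 ∂P)
          =O[atTop] (fun k : ℕ => 1 / (k : ℝ) ^ (2 * η)))) := by
  exact theorem6_general P φ M N δ hφ d F f hd.toPositiveDensityNoise θ C β hβ θ₀ η hη
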